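/- There is an absolute constant $C$ with the following property. Let $p$ be a prime, let $F$ be a finite extension of $\mathbb{Q}_p$ with ring of integers $\mathcal{O}_F$ and residue field of cardinality $q$, and let $K$ be a finite extension of $F$ with ring of integers $\mathcal{O}_K$, degree $r=[K:F]$ and residue degree $f$. Let $\|\cdot\|$ be the $p$-adic norm on $K$ normalized by $\|p\|=p^{-[F:\mathbb{Q}_p]}$, let $D_K$ be the discriminant of $K/F$ (the determinant of the trace form in an $\mathcal{O}_F$-basis of $\mathcal{O}_K$), and let $\lambda_F,\lambda_K$ be the Haar measures with $\lambda_F(\mathcal{O}_F)=1$, $\lambda_K(\mathcal{O}_K)=1$. For $m\ge 0$ let $\Omega_m\simeq\mathcal{O}_F^{m+1}$ be the space of polynomials of degree at most $m$ over $\mathcal{O}_F$, with the product measure $\lambda_F^{\otimes(m+1)}$. For $n\ge 1$ define the density function $\rho_{K,n}:K\to\mathbb{R}_{\ge 0}$ as follows. For $x\in\mathcal{O}_K$, $$\rho_{K,n}(x)=\frac{\|D_K\|}{\#(\mathcal{O}_K/\mathcal{O}_F[x])}\int_{\Omega_{n-r}}\|Q(x)\|^r\,dQ\quad\text{if } n\ge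 r \text{ and } F[x]=K,$$ and $\rho_{K,n}(x)=0$ otherwise; for $x\in K\setminus\mathcal{O}_K$, $\rho_{K,n}(x)=\|x\|^{-2r}\rho_{K,n}(x^{-1})$. Put $\rho_n(K)=\int_K\rho_{K,n}\,d\lambda_K$. Then $\rho_{K,n}$ is integrable on $K$ for $n=r$ and for every $n\ge 2r-1$, and $$\left|\frac{\rho_r(K)}{\|D_K\|}-\Bigl(1-\frac1q\Bigr)\sum_{m\mid f}\mu\Bigl(\frac fm\Bigr)q^{m-f}\right|\le \frac{C}{q^{f}},$$ $$\left|\frac{\rho_n(K)}{\|D_K\|}-\sum_{m\mid f}\mu\Bigl(\frac fm\Bigr)q^{m-f}\right|\le \frac{C}{q^{f}}\qquad\text{for all } n\ge 2r-1,$$ where $\mu$ is the Möbius function. -/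

import Mathlib

open MeasureTheory

namespace PadicRoots

/-! Throughout, a finite extension `F` of `ℚ_[p]` is given as a field with a multiplicative norm
extending the norm of `ℚ_[p]` (there is exactly one such norm, because `ℚ_[p]` is complete), and a
finite extension `K` of `F` carries in the same way the unique norm extending that of `F`. -/

section Facts

theorem isUltrametricDist_base (p : ℕ) [Fact p.Prime] (F : Type*) [NontriviallyNormedField F]
    [NormedAlgebra ℚ_[p] F] : IsUltrametricDist F :=
  IsUltrametricDist.of_normedAlgebra ℚ_[p]

theorem properSpace_base (p : ℕ) [Fact p.Prime] (F : Type*) [NontriviallyNormedField F]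
    [NormedAlgebra ℚ_[p] F] [FiniteDimensional ℚ_[p] F] : ProperSpace F :=
  FiniteDimensional.proper ℚ_[p] F

theorem isUltrametricDist_ext (F : Type*) [NontriviallyNormedField F] [IsUltrametricDist F]
    (K : Type*) [NormedField K] [NormedAlgebra F K] : IsUltrametricDist K :=
  IsUltrametricDist.of_normedAlgebra F

theorem properSpace_ext (F : Type*) [NontriviallyNormedField F] [ProperSpace F]
    (K : Type*) [NormedField K] [NormedAlgebra F K] [FiniteDimensional F K] : ProperSpace K :=
  FiniteDimensional.proper F K

theorem charZero_base (p : ℕ) [Fact p.Prime] (F : Type*) [NontriviallyNormedField F]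
    [NormedAlgebra ℚ_[p] F] : CharZero F :=
  charZero_of_injective_algebraMap (algebraMap ℚ_[p] F).injective

end Facts

/-- The ring of integers `{x : K | ‖x‖ ≤ 1}`. -/
noncomputable abbrev integers (K : Type*) [NormedField K] [IsUltrametricDist K] :
    ValuationSubring K :=
  (NormedField.valuation (K := K)).valuationSubring

theorem mem_integers {K : Type*} [NormedField K] [IsUltrametricDist K] {x : K} :
    x ∈ integers K ↔ ‖x‖ ≤ 1 := by
  rw [Valuation.mem_valuationSubring_iff, NormedField.valuation_apply, ← NNReal.coe_le_coe]
  simp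

theorem inv_mem_integers {K : Type*} [NormedField K] [IsUltrametricDist K] {x : K}
    (hx : x ∉ integers K) : x⁻¹ ∈ integers K :=
  ((integers K).mem_or_inv_mem x).resolve_left hx

section Extension

variable (F : Type*) [NontriviallyNormedField F] [IsUltrametricDist F]
  (K : Type*) [NormedField K] [IsUltrametricDist K] [NormedAlgebra F K]

/-- The norm of `K` extends the norm of `F`; this makes the ring of integers of `K` an algebra over
the ring of integers of `F`, and likewise for the residue fields. -/
instance hasExtension : (NormedField.valuation (K := F)).HasExtension
    (NormedField.valuation (K := K)) where
  val_isEquiv_comap x y := by simp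

theorem isIntegralClosure_integers [CompleteSpace F] [FiniteDimensional F K] :
    IsIntegralClosure (integers K) (integers F) K where
  algebraMap_injective := Subtype.val_injective
  isIntegral_iff {x} := by
    constructor
    · intro h
      exact IsIntegrallyClosed.isIntegral_iff.mp (h.tower_top (A := integers K))
    · rintro ⟨y, rfl⟩
      have hy : IsIntegral F (y : K) := Algebra.IsIntegral.isIntegral _
      have h1 : spectralNorm F K (y : K) ≤ 1 := by
        rw [← NormedAlgebra.norm_eq_spectralNorm F]
        exact mem_integers.mp y.2
      have h2 := (spectralValue_le_one_iff (minpoly.monic hy)).mp h1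
      have h3 : minpoly F (y : K) ∈ Polynomial.lifts (algebraMap (integers F) F) := by
        rw [Polynomial.lifts_iff_coeff_lifts]
        exact fun n => ⟨⟨_, mem_integers.mpr (h2 n)⟩, rfl⟩
      obtain ⟨P, hP, -, hm⟩ := Polynomial.lifts_and_natDegree_eq_and_monic h3 (minpoly.monic hy)
      refine ⟨P, hm, ?_⟩
      change Polynomial.eval₂ (algebraMap (integers F) K) (y : K) P = 0
      rw [IsScalarTower.algebraMap_eq (integers F) F K, ← Polynomial.eval₂_map, hP]
      exact minpoly.aeval F (y : K)

theorem isPrincipalIdealRing_integers [ProperSpace F] : IsPrincipalIdealRing (integers F) := by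
  let _ : Valued F NNReal := NormedField.toValued
  have h : IsCompact {x : F | ‖x‖ ≤ 1} := by
    simpa [Metric.closedBall] using isCompact_closedBall (0 : F) 1
  have h' : IsCompact (X := F) (Valued.integer F : Set F) := by
    convert h using 1
    ext x
    exact mem_integers
  have : CompactSpace (Valued.integer F) := isCompact_iff_compactSpace.mp h'
  exact Valued.integer.isPrincipalIdealRing_of_compactSpace (K := F)

theorem free_integers [CharZero F] [ProperSpace F] [FiniteDimensional F K] :
    Module.Free (integers F) (integers K) :=
  haveI := isIntegralClosure_integers F K
  haveI := isPrincipalIdealRing_integers F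
  IsIntegralClosure.module_free (integers F) F K (integers K)

theorem finite_integers [CharZero F] [ProperSpace F] [FiniteDimensional F K] :
    Module.Finite (integers F) (integers K) :=
  haveI := isIntegralClosure_integers F K
  haveI := isPrincipalIdealRing_integers F
  IsIntegralClosure.finite (integers F) F K (integers K)

end Extension

section Measure

variable (K : Type*) [NormedField K] [ProperSpace K]

/-- The unit ball `{x : K | ‖x‖ ≤ 1}`, which is the set underlying the ring of integers. -/
noncomputable def unitBall : TopologicalSpace.PositiveCompacts K where
  carrier := Metric.closedBall 0 1
  isCompact' := isCompact_closedBall 0 1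
  interior_nonempty' :=
    ⟨0, Metric.ball_subset_interior_closedBall (Metric.mem_ball_self one_pos)⟩

/-- The additive Haar measure on `K` giving measure `1` to the ring of integers. -/
noncomputable def haar [MeasurableSpace K] [BorelSpace K] : Measure K :=
  Measure.addHaarMeasure (unitBall K)

end Measure

section Residue

variable (F : Type*) [NontriviallyNormedField F] [IsUltrametricDist F]
  (K : Type*) [NormedField K] [IsUltrametricDist K] [NormedAlgebra F K]

/-- The cardinality `q` of the residue field of `F`. -/
noncomputable def residueCard : ℕ :=
  Nat.card (IsLocalRing.ResidueField (integers F))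

/-- The residue degree of `K / F`: the degree of the extension of residue fields. -/
noncomputable def residueDegree : ℕ :=
  Module.finrank (IsLocalRing.ResidueField (integers F)) (IsLocalRing.ResidueField (integers K))

variable {K} in
/-- The index of `𝒪_F[x]` in `𝒪_K`, for `x` in `𝒪_K` (and `0` if the index is infinite). -/
noncomputable def orderIndex (x : integers K) : ℕ :=
  Nat.card (integers K ⧸ Subalgebra.toSubmodule (Algebra.adjoin (integers F) {x}))

end Residue

section Density

variable (p : ℕ) [Fact p.Prime]
  (F : Type*) [NontriviallyNormedField F] [NormedAlgebra ℚ_[p] F]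
  {K : Type*} [NormedField K] [NormedAlgebra F K]

/-- The norm on finite extensions of `F` normalized by `p ↦ p ^ (-[F : ℚ_[p]])`. -/
noncomputable def nrm (x : K) : ℝ :=
  ‖x‖ ^ Module.finrank ℚ_[p] F

variable (K) in
/-- The normalized norm of the discriminant of `K / F`, which is the determinant of the trace form
in a basis of `𝒪_K` over `𝒪_F`. -/
noncomputable def nrmDisc [IsUltrametricDist F] [ProperSpace F] [IsUltrametricDist K]
    [FiniteDimensional F K] : ℝ :=
  haveI := charZero_base p F
  haveI := free_integers F K
  haveI := finite_integers F K
  nrm p F (Algebra.discr F fun i =>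
    ((Module.Free.chooseBasis (integers F) (integers K) i : integers K) : K))

/-- The integral of `‖Q(x)‖ ^ r`, where `r = [K : F]`, over the polynomials `Q` of degree at most
`m` with coefficients in `𝒪_F`. -/
noncomputable def polyIntegral [IsUltrametricDist F] [ProperSpace F] [MeasurableSpace F]
    [BorelSpace F] (m : ℕ) (x : K) : ℝ :=
  ∫ c in {c : Fin (m + 1) → F | ∀ i, c i ∈ integers F},
    nrm p F (∑ i, c i • x ^ (i : ℕ)) ^ Module.finrank F K ∂(Measure.pi fun _ => haar F)

variable [IsUltrametricDist F] [ProperSpace F] [IsUltrametricDist K] [FiniteDimensional F K]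
  [MeasurableSpace F] [BorelSpace F]

open Classical in
/-- The density function `ρ_{K,n}` on `𝒪_K`. -/
noncomputable def densityInt (n : ℕ) (x : integers K) : ℝ :=
  if Module.finrank F K ≤ n ∧ Algebra.adjoin F {(x : K)} = ⊤ then
    nrmDisc p F K / orderIndex F x * polyIntegral p F (n - Module.finrank F K) (x : K)
  else 0

open Classical in
/-- The density function `ρ_{K,n}` on `K`, extended from `𝒪_K` to `K` by
`ρ_{K,n}(x) = ‖x‖ ^ (-2r) ρ_{K,n}(x⁻¹)` for `x ∉ 𝒪_K`. -/
noncomputable def density (n : ℕ) (x : K) : ℝ :=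
  if hx : x ∈ integers K then densityInt p F n ⟨x, hx⟩
  else (nrm p F x ^ (2 * Module.finrank F K))⁻¹ * densityInt p F n ⟨x⁻¹, inv_mem_integers hx⟩

variable (K) in
/-- `ρ_n(K)`, the integral over `K` of the density function `ρ_{K,n}`. -/
noncomputable def rho [ProperSpace K] [MeasurableSpace K] [BorelSpace K] (n : ℕ) : ℝ :=
  ∫ x : K, density p F n x ∂(haar K)

end Density

/-- The sum of `μ(f / m) q ^ (m - f)` over the positive divisors `m` of `f`. -/
noncomputable def mobiusSum (q f : ℕ) : ℝ :=
  ∑ m ∈ f.divisors, (ArithmeticFunction.moebius (f / m) : ℝ) * (q : ℝ) ^ ((m : ℤ) - (f : ℤ))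

end PadicRoots

/-! Write Q = q^f for the size of the residue field of K, r = [K:F], and divide everything by the
norm of the discriminant. On 𝒪_K what remains is `weight`: the inverse index of 𝒪_F[x] times
`polyIntegral`, a number in [0, 1]. Split 𝒪_K into its Q residue classes, each a ball of measure
1/Q.

Suppose the class generates the residue extension. A lift φ of its minimal polynomial has unit
derivative on the class, so outside one ball of measure at most 1/Q² the value φ(x) is a
uniformizer, and then 𝒪_F[x] = 𝒪_K (`exists_forall_adjoin_eq_top`). There the weight is just the
polynomial integral. For n = r this averages constants, which are units with probability 1 - 1/q, so
it is 1 - 1/q up to q^(-r). For n ≥ 2r - 1 there are at least f coefficients, the reduction of the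
value at x takes every value in the residue field, and the integral is 1 up to 1/Q
(`one_sub_le_polyIntegral`). Möbius inversion over the subfields of the residue field counts Q ·
`mobiusSum` such classes, which produces the main term.

Suppose instead that the class has degree d < f. The index is infinite or at least q^(f-d), so the
class contributes at most q^d / Q². Since proper divisors of f are at most f/2, all these classes
together contribute at most 2/Q.

Outside 𝒪_K the factor ‖x‖^(-2r) equals Q^(-2k) on the k-th shell, of measure at most Q^k, so the
tail is at most 2/Q. This uses that the normalized norm of a uniformizer of K has r-th power 1/Q
(`nrm_uniformizer`), obtained by computing Haar measures of balls in two ways. The errors 1/Q, 2/Q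
and 2/Q add up to C = 5. -/

namespace PadicRoots

open IsLocalRing Metric
open scoped ENNReal

/-! ### Uniformizers and finite residue fields -/

section Uniformizer

variable {K : Type*} [NontriviallyNormedField K]

/-- An element of maximal norm among the elements of norm less than `1`. -/
structure IsUniformizer (π : K) : Prop where
  norm_pos : 0 < ‖π‖
  norm_lt_one : ‖π‖ < 1
  norm_le {x : K} : ‖x‖ < 1 → ‖x‖ ≤ ‖π‖

theorem IsUniformizer.ne_zero {π : K} (h : IsUniformizer π) : π ≠ 0 :=
  norm_pos_iff.mp h.norm_pos

theorem IsUniformizer.exists_zpow {π : K} (h : IsUniformizer π) {x : K} (hx : x ≠ 0) :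
    ∃ n : ℤ, ‖x‖ = ‖π‖ ^ n := by
  obtain ⟨n, hn1, hn2⟩ := exists_mem_Ioc_zpow (norm_pos_iff.mpr hx)
    ((one_lt_inv₀ h.norm_pos).mpr h.norm_lt_one)
  refine ⟨-(n + 1), ?_⟩
  have h0 := zpow_pos h.norm_pos (n + 1)
  rw [inv_zpow] at hn1 hn2
  rw [zpow_neg]
  refine le_antisymm hn2 ?_
  -- If the upper bound were strict, x π^(n+1) would have norm strictly between ‖π‖ and 1, against
  -- maximality of ‖π‖.
  by_contra! hlt
  have h1 : ‖x * π ^ (n + 1)‖ < 1 := by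
    rw [norm_mul, norm_zpow]
    calc _ < (‖π‖ ^ (n + 1))⁻¹ * ‖π‖ ^ (n + 1) := by gcongr
      _ = 1 := inv_mul_cancel₀ h0.ne'
  have h2 := h.norm_le h1
  rw [norm_mul, norm_zpow, zpow_add_one₀ h.norm_pos.ne', ← mul_assoc] at h2
  have h3 : ‖x‖ * ‖π‖ ^ n ≤ 1 := le_of_mul_le_mul_right (by linarith) h.norm_pos
  have h4 := zpow_pos h.norm_pos n
  have h5 : 1 < ‖x‖ * ‖π‖ ^ n := by
    calc 1 = (‖π‖ ^ n)⁻¹ * ‖π‖ ^ n := (inv_mul_cancel₀ h4.ne').symm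
      _ < _ := by gcongr
  linarith

/-- In an ultrametric space the open unit ball is also closed, hence compact here, so the norm
attains its maximum on it. -/
theorem exists_isUniformizer [IsUltrametricDist K] [ProperSpace K] :
    ∃ π : K, IsUniformizer π := by
  obtain ⟨y, hy0, hy1⟩ := NormedField.exists_norm_lt_one K
  have hc : IsCompact (ball (0 : K) 1) :=
    (isCompact_closedBall (0 : K) 1).of_isClosed_subset (IsUltrametricDist.isClosed_ball _ _)
      ball_subset_closedBall
  obtain ⟨π, hπ, hmax⟩ := hc.exists_isMaxOn ⟨0, mem_ball_self one_pos⟩ continuous_norm.continuousOn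
  refine ⟨π, ?_, by simpa using hπ, fun {x} hx => hmax (by simpa using hx)⟩
  exact hy0.trans_le (hmax (show y ∈ ball 0 1 by simpa using hy1))

end Uniformizer

section Residue

variable {K : Type*} [NormedField K] [IsUltrametricDist K]

theorem norm_sub_le_max (x y : K) : ‖x - y‖ ≤ max ‖x‖ ‖y‖ := by
  simpa [sub_eq_add_neg] using IsUltrametricDist.norm_add_le_max x (-y)

theorem norm_coe_le_one (x : integers K) : ‖(x : K)‖ ≤ 1 := mem_integers.mp x.2

theorem isUnit_integers_iff {x : integers K} : IsUnit x ↔ ‖(x : K)‖ = 1 := by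
  constructor
  · rintro ⟨u, rfl⟩
    have h1 := norm_coe_le_one (u : integers K)
    have h2 := norm_coe_le_one ((u⁻¹ : (integers K)ˣ) : integers K)
    have h3 : ((u : integers K) : K) * ((u⁻¹ : (integers K)ˣ) : integers K) = 1 := by
      rw [← MulMemClass.coe_mul]; simp
    have h4 := congrArg norm h3
    rw [norm_mul, norm_one] at h4
    nlinarith [norm_nonneg ((u : integers K) : K),
      norm_nonneg (((u⁻¹ : (integers K)ˣ) : integers K) : K)]
  · intro h
    have h0 : (x : K) ≠ 0 := by rintro h0; simp [h0] at h
    refine IsUnit.of_mul_eq_one ⟨(x : K)⁻¹, mem_integers.mpr (by simp [h])⟩ ?_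
    ext
    simp [h0]

theorem residue_eq_zero {x : integers K} : residue (integers K) x = 0 ↔ ‖(x : K)‖ < 1 := by
  rw [residue_eq_zero_iff, mem_maximalIdeal, mem_nonunits_iff, isUnit_integers_iff]
  exact ⟨fun h => lt_of_le_of_ne (norm_coe_le_one x) h, fun h => h.ne⟩

theorem residue_eq_residue {x y : integers K} :
    residue (integers K) x = residue (integers K) y ↔ ‖(x - y : K)‖ < 1 := by
  rw [← sub_eq_zero, ← map_sub, residue_eq_zero]
  rfl

/-- The maximal ideal is an open subgroup of the compact group 𝒪_K, so it has finite index. -/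
theorem finite_residueField [ProperSpace K] : Finite (ResidueField (integers K)) := by
  have hc : IsCompact (integers K : Set K) := by
    convert isCompact_closedBall (0 : K) 1
    ext x
    rw [mem_closedBall_zero_iff]
    exact mem_integers
  have : CompactSpace (integers K) := isCompact_iff_compactSpace.mp hc
  let I : AddSubgroup (integers K) := (residue (integers K)).toAddMonoidHom.ker
  have hI : (I : Set (integers K)) = (fun x : integers K => ‖(x : K)‖) ⁻¹' Set.Iio 1 := by
    ext x
    exact residue_eq_zero
  have hopen : IsOpen (I : Set (integers K)) := by
    rw [hI]
    exact isOpen_Iio.preimage (by fun_prop)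
  have := AddSubgroup.quotient_finite_of_isOpen I hopen
  exact Finite.of_equiv _ (QuotientAddGroup.quotientKerEquivOfSurjective
    (residue (integers K)).toAddMonoidHom residue_surjective).toEquiv

theorem residueCard_pos [ProperSpace K] : 0 < Nat.card (ResidueField (integers K)) :=
  have := finite_residueField (K := K)
  Nat.card_pos

theorem one_lt_residueCard [ProperSpace K] : 1 < Nat.card (ResidueField (integers K)) :=
  have := finite_residueField (K := K)
  Finite.one_lt_card

end Residue

/-! ### Haar measure of balls by counting translates -/

section Translates

variable {V : Type*} [AddGroup V] [MeasurableSpace V]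
  (μ : Measure V) [μ.IsAddLeftInvariant] {ι : Type*} [Finite ι]

open Pointwise in
/-- If finitely many disjoint translates of `S` lie in `B`, then the measures compare. -/
theorem card_mul_measure_le [MeasurableAdd V] {S B : Set V} (hS : MeasurableSet S) (t : ι → V)
    (hsub : ∀ i, ∀ s ∈ S, t i + s ∈ B)
    (hdisj : ∀ i j, ∀ s ∈ S, ∀ s' ∈ S, t i + s = t j + s' → i = j) :
    (Nat.card ι : ℝ≥0∞) * μ S ≤ μ B := by
  have := Fintype.ofFinite ι
  have h1 : μ (⋃ i, t i +ᵥ S) = Nat.card ι * μ S := by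
    rw [measure_iUnion, tsum_fintype]
    · simp [measure_vadd]
    · intro i j hij
      rw [Function.onFun, Set.disjoint_left]
      rintro _ ⟨s, hs, rfl⟩ ⟨s', hs', h⟩
      exact hij (hdisj i j s hs s' hs' h.symm)
    · intro i
      exact hS.const_vadd (t i)
  rw [← h1]
  refine measure_mono (Set.iUnion_subset fun i => ?_)
  rintro _ ⟨s, hs, rfl⟩
  exact hsub i s hs

open Pointwise in
theorem measure_le_card_mul {S B : Set V} (t : ι → V)
    (hcov : ∀ b ∈ B, ∃ i, ∃ s ∈ S, b = t i + s) :
    μ B ≤ (Nat.card ι : ℝ≥0∞) * μ S := by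
  have := Fintype.ofFinite ι
  calc μ B ≤ μ (⋃ i, t i +ᵥ S) := by
        refine measure_mono fun b hb => ?_
        obtain ⟨i, s, hs, rfl⟩ := hcov b hb
        exact Set.mem_iUnion.mpr ⟨i, s, hs, rfl⟩
    _ ≤ ∑ i, μ (t i +ᵥ S) := measure_iUnion_fintype_le _ _
    _ = _ := by simp [measure_vadd]

end Translates

section Haar

variable (K : Type*) [NontriviallyNormedField K] [ProperSpace K] [MeasurableSpace K]
  [BorelSpace K]

instance isAddHaarMeasure_haar : (haar K).IsAddHaarMeasure := by
  unfold haar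
  infer_instance

theorem haar_closedBall_one : haar K (closedBall 0 1) = 1 :=
  Measure.addHaarMeasure_self

variable {K} [IsUltrametricDist K]

/-- The larger ball is the disjoint union of the translates of the smaller one by π^n t, with t
running over representatives of the residue field. -/
theorem haar_closedBall_zpow_succ {π : K} (hπ : IsUniformizer π) (n : ℤ) :
    haar K (closedBall 0 (‖π‖ ^ n)) =
      Nat.card (ResidueField (integers K)) * haar K (closedBall 0 (‖π‖ ^ (n + 1))) := by
  have := finite_residueField (K := K)
  have hpn : (0 : ℝ) < ‖π‖ ^ n := zpow_pos hπ.norm_pos n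
  have hπn : π ^ n ≠ 0 := zpow_ne_zero _ hπ.ne_zero
  have hle : ‖π‖ ^ (n + 1) ≤ ‖π‖ ^ n :=
    zpow_le_zpow_right_of_le_one₀ hπ.norm_pos hπ.norm_lt_one.le (by lia)
  choose t ht using residue_surjective (R := integers K)
  refine le_antisymm ?_ ?_
  · refine measure_le_card_mul _ (fun a => π ^ n * (t a : K)) fun b hb => ?_
    have hb' : ‖b / π ^ n‖ ≤ 1 := by
      rw [norm_div, norm_zpow]
      exact div_le_one_of_le₀ (by simpa using hb) hpn.le
    let c : integers K := ⟨b / π ^ n, mem_integers.mpr hb'⟩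
    refine ⟨residue _ c, b - π ^ n * t (residue _ c), ?_, by ring⟩
    have h1 := hπ.norm_le (residue_eq_residue.mp (ht (residue _ c)).symm)
    rw [mem_closedBall_zero_iff, zpow_add_one₀ hπ.norm_pos.ne', ← norm_zpow]
    calc _ = ‖π ^ n‖ * ‖(c : K) - t (residue _ c)‖ := by
          rw [← norm_mul, mul_sub]
          congr 2
          exact (mul_div_cancel₀ b hπn).symm
      _ ≤ _ := by gcongr
  · refine card_mul_measure_le _ isClosed_closedBall.measurableSet (fun a => π ^ n * (t a : K))
      ?_ ?_
    · intro a s hs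
      rw [mem_closedBall_zero_iff] at hs ⊢
      refine (IsUltrametricDist.norm_add_le_max _ _).trans (max_le ?_ (hs.trans hle))
      rw [norm_mul, norm_zpow]
      exact mul_le_of_le_one_right hpn.le (norm_coe_le_one _)
    · intro a b s hs s' hs' h
      rw [← ht a, ← ht b, residue_eq_residue]
      rw [mem_closedBall_zero_iff] at hs hs'
      have h1 : π ^ n * ((t a : K) - t b) = s' - s := by linear_combination h
      have h2 : ‖s' - s‖ ≤ ‖π‖ ^ (n + 1) :=
        (norm_sub_le_max _ _).trans (max_le hs' hs)
      rw [← h1, norm_mul, norm_zpow, zpow_add_one₀ hπ.norm_pos.ne'] at h2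
      exact (le_of_mul_le_mul_left h2 hpn).trans_lt hπ.norm_lt_one

theorem haar_closedBall_zpow {π : K} (hπ : IsUniformizer π) (n : ℤ) :
    haar K (closedBall 0 (‖π‖ ^ n)) = (Nat.card (ResidueField (integers K)) : ℝ≥0∞) ^ (-n) := by
  have hQ0 : (Nat.card (ResidueField (integers K)) : ℝ≥0∞) ≠ 0 := by
    exact_mod_cast (residueCard_pos (K := K)).ne'
  have hQt : (Nat.card (ResidueField (integers K)) : ℝ≥0∞) ≠ ∞ := ENNReal.natCast_ne_top _
  induction n using Int.induction_on with
  | zero => simpa using haar_closedBall_one K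
  | succ n ih =>
    rw [haar_closedBall_zpow_succ hπ] at ih
    rw [neg_add, ENNReal.zpow_add hQ0 hQt, ← ih, zpow_neg_one, mul_comm, ← mul_assoc,
      ENNReal.inv_mul_cancel hQ0 hQt, one_mul]
  | pred n ih =>
    have h := haar_closedBall_zpow_succ hπ (-(n : ℤ) - 1)
    rw [sub_add_cancel, ih] at h
    rw [h, neg_sub, sub_neg_eq_add, ENNReal.zpow_add hQ0 hQt, zpow_one, neg_neg]

theorem haar_ball_one :
    haar K (ball 0 1) = (Nat.card (ResidueField (integers K)) : ℝ≥0∞)⁻¹ := by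
  obtain ⟨π, hπ⟩ := exists_isUniformizer (K := K)
  have : ball (0 : K) 1 = closedBall 0 (‖π‖ ^ (1 : ℤ)) := by
    ext x
    simp only [mem_ball_zero_iff, mem_closedBall_zero_iff, zpow_one]
    exact ⟨hπ.norm_le, fun h => h.trans_lt hπ.norm_lt_one⟩
  rw [this, haar_closedBall_zpow hπ, zpow_neg_one]

end Haar

end PadicRoots

namespace PadicRoots

open IsLocalRing Metric
open scoped ENNReal

/-! ### Integral bases and the scaling of Haar measure by elements of the base field -/

section Extension

variable (F : Type*) [NontriviallyNormedField F] [IsUltrametricDist F]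
  (K : Type*) [NormedField K] [IsUltrametricDist K] [NormedAlgebra F K]

theorem coe_smul_integers (c : integers F) (x : integers K) :
    ((c • x : integers K) : K) = (c : F) • (x : K) := by
  rw [Algebra.smul_def, Algebra.smul_def]
  rfl

variable [ProperSpace F] [FiniteDimensional F K]

theorem finite_residueField_ext :
    Module.Finite (ResidueField (integers F)) (ResidueField (integers K)) :=
  haveI := properSpace_ext F K
  haveI := finite_residueField (K := K)
  Module.Finite.of_finite

theorem residueCard_ext : Nat.card (ResidueField (integers K)) =
    residueCard F ^ residueDegree F K := by
  have := finite_residueField_ext F K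
  exact Module.natCard_eq_pow_finrank

variable [CharZero F]

/-- A basis of `𝒪_K` over `𝒪_F`, viewed as a basis of `K` over `F`. -/
noncomputable def integralBasis :
    Module.Basis (haveI := free_integers F K; Module.Free.ChooseBasisIndex (integers F) (integers K))
      F K :=
  haveI := free_integers F K
  haveI := isIntegralClosure_integers F K
  haveI := IsIntegralClosure.isLocalization (integers F) F K (integers K)
  Module.Basis.localizationLocalization F (nonZeroDivisors (integers F)) K
    (Module.Free.chooseBasis (integers F) (integers K))

theorem integralBasis_apply (i) : haveI := free_integers F K
    integralBasis F K i = (Module.Free.chooseBasis (integers F) (integers K) i : integers K) := by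
  have := free_integers F K
  have := isIntegralClosure_integers F K
  have := IsIntegralClosure.isLocalization (integers F) F K (integers K)
  exact Module.Basis.localizationLocalization_apply F (nonZeroDivisors (integers F)) K _ i

noncomputable instance : Fintype
    (haveI := free_integers F K; Module.Free.ChooseBasisIndex (integers F) (integers K)) :=
  haveI := free_integers F K
  haveI := finite_integers F K
  inferInstance

theorem norm_integralBasis_le (i) : ‖integralBasis F K i‖ ≤ 1 := by
  rw [integralBasis_apply]
  exact norm_coe_le_one _

variable {K} in
theorem norm_integralBasis_repr_le {x : K} (hx : ‖x‖ ≤ 1) (i) :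
    ‖(integralBasis F K).repr x i‖ ≤ 1 := by
  have := free_integers F K
  have := isIntegralClosure_integers F K
  have := IsIntegralClosure.isLocalization (integers F) F K (integers K)
  have h := Module.Basis.localizationLocalization_repr_algebraMap F (nonZeroDivisors (integers F)) K
    (Module.Free.chooseBasis (integers F) (integers K)) ⟨x, mem_integers.mpr hx⟩ i
  change (integralBasis F K).repr x i = _ at h
  rw [h]
  exact norm_coe_le_one _

variable {K} in
theorem norm_integralBasis_repr_le_norm {x : K} {c : F} (hc : c ≠ 0) (hx : ‖x‖ ≤ ‖c‖) (i) :
    ‖(integralBasis F K).repr x i‖ ≤ ‖c‖ := by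
  have hc' : 0 < ‖c‖ := norm_pos_iff.mpr hc
  have h : ‖c⁻¹ • x‖ ≤ 1 := by
    rw [norm_smul, norm_inv]
    exact (inv_mul_le_one₀ hc').mpr hx
  have h2 := norm_integralBasis_repr_le F h i
  rw [map_smul, Finsupp.smul_apply, smul_eq_mul, norm_mul, norm_inv] at h2
  exact (inv_mul_le_one₀ hc').mp h2

theorem card_chooseBasisIndex : haveI := free_integers F K
    Nat.card (Module.Free.ChooseBasisIndex (integers F) (integers K)) = Module.finrank F K := by
  rw [Module.finrank_eq_nat_card_basis (integralBasis F K)]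

theorem nrmDisc_pos (p : ℕ) [Fact p.Prime] [NormedAlgebra ℚ_[p] F] : 0 < nrmDisc p F K := by
  unfold nrmDisc nrm
  refine pow_pos (norm_pos_iff.mpr ?_) _
  have h := Algebra.discr_not_zero_of_basis F (integralBasis F K)
  convert h using 3
  exact (integralBasis_apply F K _).symm

/-- Coordinates in an integral basis identify 𝒪_K / π𝒪_K with r copies of the residue field of F, so
q^r translates of π𝒪_K tile 𝒪_K. -/
theorem haar_closedBall_base [ProperSpace K] [MeasurableSpace K] [BorelSpace K]
    {π : F} (hπ : IsUniformizer π) :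
    (residueCard F : ℝ≥0∞) ^ Module.finrank F K * haar K (closedBall 0 ‖π‖) =
      haar K (closedBall 0 1) := by
  have := finite_residueField (K := F)
  choose t ht using residue_surjective (R := integers F)
  have hcard : (residueCard F : ℝ≥0∞) ^ Module.finrank F K = Nat.card ((haveI := free_integers F K;
      Module.Free.ChooseBasisIndex (integers F) (integers K)) → ResidueField (integers F)) := by
    rw [Nat.card_fun, card_chooseBasisIndex, residueCard]
    push_cast
    rfl
  have hadd : (haar K).IsAddLeftInvariant := by
    unfold haar
    infer_instance
  have hle : ∀ c : (haveI := free_integers F K;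
      Module.Free.ChooseBasisIndex (integers F) (integers K)) → F, ∀ ρ : ℝ, 0 ≤ ρ →
      (∀ i, ‖c i‖ ≤ ρ) → ‖∑ i, c i • integralBasis F K i‖ ≤ ρ := by
    intro c ρ hρ hc
    refine IsUltrametricDist.norm_sum_le_of_forall_le_of_nonneg hρ fun i _ => ?_
    rw [norm_smul]
    exact (mul_le_of_le_one_right (norm_nonneg _) (norm_integralBasis_le F K i)).trans (hc i)
  rw [hcard]
  refine le_antisymm ?_ ?_
  · refine card_mul_measure_le _ isClosed_closedBall.measurableSet
      (fun a => ∑ i, (t (a i) : F) • integralBasis F K i) ?_ ?_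
    · intro a s hs
      rw [mem_closedBall_zero_iff] at hs ⊢
      exact (IsUltrametricDist.norm_add_le_max _ _).trans
        (max_le (hle _ _ zero_le_one fun i => norm_coe_le_one _) (hs.trans hπ.norm_lt_one.le))
    · intro a b s hs s' hs' h
      rw [mem_closedBall_zero_iff] at hs hs'
      have h1 : ∑ i, ((t (a i) : F) - t (b i)) • integralBasis F K i = s' - s := by
        simp only [sub_smul, Finset.sum_sub_distrib]
        linear_combination h
      funext i
      have h2 := norm_integralBasis_repr_le_norm F hπ.ne_zero
        ((norm_sub_le_max _ _).trans (max_le hs' hs)) i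
      rw [← h1, Module.Basis.repr_sum_self] at h2
      rw [← ht (a i), ← ht (b i), residue_eq_residue]
      exact h2.trans_lt hπ.norm_lt_one
  · refine measure_le_card_mul _ (fun a => ∑ i, (t (a i) : F) • integralBasis F K i) ?_
    intro x hx
    rw [mem_closedBall_zero_iff] at hx
    let c := fun i => (⟨(integralBasis F K).repr x i,
      mem_integers.mpr (norm_integralBasis_repr_le F hx i)⟩ : integers F)
    refine ⟨fun i => residue _ (c i), x - ∑ i, (t (residue _ (c i)) : F) • integralBasis F K i, ?_,
      by ring⟩
    rw [mem_closedBall_zero_iff]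
    nth_rw 1 [← (integralBasis F K).sum_repr x]
    rw [← Finset.sum_sub_distrib]
    simp only [← sub_smul]
    refine hle _ _ (norm_nonneg _) fun i => hπ.norm_le ?_
    exact residue_eq_residue.mp (ht (residue _ (c i))).symm

end Extension

/-! ### Ramification index and the normalization of the norm -/

section Ramification

variable (F : Type*) [NontriviallyNormedField F] [IsUltrametricDist F] [ProperSpace F] [CharZero F]
  (K : Type*) [NontriviallyNormedField K] [IsUltrametricDist K] [NormedAlgebra F K]
  [FiniteDimensional F K]

/-- The ball of radius ‖π‖ = ‖ϖ‖^e in K has measure Q^(-e) by powers of ϖ and q^(-r) by an integral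
basis. This is the identity ef = r in measure form. -/
theorem exists_ramification {π : F} {ϖ : K} (hπ : IsUniformizer π) (hϖ : IsUniformizer ϖ) :
    ∃ e : ℕ, e ≠ 0 ∧ ‖π‖ = ‖ϖ‖ ^ e ∧
      Nat.card (ResidueField (integers K)) ^ e = residueCard F ^ Module.finrank F K := by
  have := properSpace_ext F K
  borelize K
  obtain ⟨e, he⟩ := hϖ.exists_zpow (x := algebraMap F K π) (by simpa using hπ.ne_zero)
  rw [norm_algebraMap'] at he
  have he0 : 0 < e := by
    by_contra! h
    have h1 := one_le_zpow_of_nonpos₀ hϖ.norm_pos hϖ.norm_lt_one.le h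
    rw [← he] at h1
    exact absurd hπ.norm_lt_one h1.not_gt
  lift e to ℕ using he0.le
  refine ⟨e, by lia, by simpa using he, ?_⟩
  have h1 := haar_closedBall_base F K hπ
  rw [he, haar_closedBall_zpow hϖ, haar_closedBall_one, ENNReal.zpow_neg, zpow_natCast] at h1
  have h2 := (ENNReal.eq_inv_of_mul_eq_one_left h1)
  rw [inv_inv] at h2
  exact_mod_cast h2.symm

theorem residueDegree_le : residueDegree F K ≤ Module.finrank F K := by
  have := properSpace_ext F K
  obtain ⟨π, hπ⟩ := exists_isUniformizer (K := F)
  obtain ⟨ϖ, hϖ⟩ := exists_isUniformizer (K := K)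
  obtain ⟨e, he, -, h⟩ := exists_ramification F K hπ hϖ
  rw [residueCard_ext F K, ← pow_mul] at h
  rw [← Nat.pow_right_injective (one_lt_residueCard (K := F)) h]
  exact Nat.le_mul_of_pos_right _ (Nat.pos_of_ne_zero he)

-- After raising to the power e, both sides become q^(-r) = Q^(-e), and nonnegative e-th roots are
-- unique. It is applied to F over ℚ_[p] with d = 1, and to K over F with d = [F : ℚ_[p]].
variable {F K} in
theorem norm_uniformizer_pow {π : F} {ϖ : K} (hπ : IsUniformizer π) (hϖ : IsUniformizer ϖ) {d : ℕ}
    (hd : ‖π‖ ^ d = (residueCard F : ℝ)⁻¹) :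
    ‖ϖ‖ ^ (d * Module.finrank F K) = (Nat.card (ResidueField (integers K)) : ℝ)⁻¹ := by
  obtain ⟨e, he, h1, h2⟩ := exists_ramification F K hπ hϖ
  refine (pow_left_inj₀ (by positivity) (by positivity) he).mp ?_
  rw [inv_pow, ← Nat.cast_pow, h2, Nat.cast_pow, ← inv_pow, ← hd, h1]
  ring

end Ramification

section Padic

variable (p : ℕ) [Fact p.Prime]

theorem isUniformizer_p : IsUniformizer (p : ℚ_[p]) where
  norm_pos := by simpa using (Fact.out : p.Prime).pos
  norm_lt_one := Padic.norm_p_lt_one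
  norm_le {x} hx := by
    have h := (PadicInt.norm_lt_one_iff_dvd (⟨x, hx.le⟩ : ℤ_[p])).mp hx
    obtain ⟨y, hy⟩ := h
    have hy' : x = (p : ℚ_[p]) * y := congrArg Subtype.val hy
    rw [hy', norm_mul]
    exact mul_le_of_le_one_right (norm_nonneg _) y.2

theorem residueCard_padic : residueCard ℚ_[p] = p := by
  have hp := isUniformizer_p p
  have hinj : Function.Injective fun n : Fin p => residue (integers ℚ_[p]) (n : ℕ) := by
    intro m n h
    have h1 := residue_eq_residue.mp h
    push_cast at h1
    have h2 : ‖(((m : ℕ) - (n : ℕ) : ℤ) : ℚ_[p])‖ < 1 := by simpa using h1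
    rw [Padic.norm_intCast_lt_one_iff] at h2
    obtain ⟨c, hc⟩ := h2
    ext
    have hm := m.2
    have hn := n.2
    have hp0 : (0 : ℤ) < p := by lia
    have : c = 0 := by
      have : c < 1 := by
        by_contra! h; nlinarith
      have : -1 < c := by
        by_contra! h; nlinarith
      lia
    subst this
    lia
  have hsurj : Function.Surjective fun n : Fin p => residue (integers ℚ_[p]) (n : ℕ) := by
    intro a
    obtain ⟨x, rfl⟩ := residue_surjective a
    obtain ⟨y, hy⟩ : ∃ y : ℤ_[p], (y : ℚ_[p]) = x := ⟨⟨x, norm_coe_le_one x⟩, rfl⟩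
    obtain ⟨n, hn, h⟩ := PadicInt.exists_mem_range y
    refine ⟨⟨n, hn⟩, ?_⟩
    rw [mem_maximalIdeal, PadicInt.mem_nonunits] at h
    have h' : ‖((x : ℚ_[p]) - (n : ℚ_[p]))‖ < 1 := by
      rwa [PadicInt.norm_def, PadicInt.coe_sub, PadicInt.coe_natCast, hy] at h
    exact Eq.symm (residue_eq_residue.mpr (by simpa using h'))
  rw [residueCard, ← Nat.card_eq_of_bijective _ ⟨hinj, hsurj⟩, Nat.card_fin]

variable {F : Type*} [NontriviallyNormedField F] [IsUltrametricDist F] [NormedAlgebra ℚ_[p] F]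
  [FiniteDimensional ℚ_[p] F]

theorem nrm_uniformizer_base {π : F} (hπ : IsUniformizer π) :
    ‖π‖ ^ Module.finrank ℚ_[p] F = (residueCard F : ℝ)⁻¹ := by
  have h := norm_uniformizer_pow (isUniformizer_p p) hπ (d := 1)
    (by rw [residueCard_padic, pow_one, Padic.norm_p])
  rwa [one_mul] at h

theorem nrm_uniformizer [ProperSpace F] [CharZero F] {K : Type*} [NontriviallyNormedField K]
    [IsUltrametricDist K] [NormedAlgebra F K] [FiniteDimensional F K] {ϖ : K}
    (hϖ : IsUniformizer ϖ) :
    nrm p F ϖ ^ Module.finrank F K = (Nat.card (ResidueField (integers K)) : ℝ)⁻¹ := by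
  obtain ⟨π, hπ⟩ := exists_isUniformizer (K := F)
  rw [nrm, ← pow_mul]
  exact norm_uniformizer_pow hπ hϖ (nrm_uniformizer_base p hπ)

end Padic

end PadicRoots

namespace PadicRoots

/-! ### Counting elements of a finite field by degree -/

section FiniteField

open Polynomial Finset

variable (k l : Type*) [Field k] [Field l] [Finite k] [Fintype l] [Algebra k l]

-- The solutions form the fixed field of σ^m, σ being the Frobenius. As σ^m has order f/m in the
-- Galois group, that field has degree m over k.
open IntermediateField in
theorem card_pow_card_pow_eq_self {m : ℕ} (hm : m ∣ Module.finrank k l) :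
    Nat.card {a : l // a ^ Nat.card k ^ m = a} = Nat.card k ^ m := by
  have := Fintype.ofFinite k
  have hl : 0 < Module.finrank k l := Module.finrank_pos
  have hm0 : m ≠ 0 := by rintro rfl; simp at hm; lia
  let σ : Gal(l/k) := FiniteField.frobeniusAlgEquivOfAlgebraic k l
  have hσ (n : ℕ) (a : l) : (σ ^ n) a = a ^ Nat.card k ^ n := by
    induction n generalizing a with
    | zero => simp
    | succ n ih =>
      rw [pow_succ, AlgEquiv.mul_apply, ih, pow_succ', pow_mul, Nat.card_eq_fintype_card]
      rfl
  let H := Subgroup.zpowers (σ ^ m)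
  have hH : Nat.card H = Module.finrank k l / m := by
    rw [Nat.card_zpowers, orderOf_pow' _ hm0,
      FiniteField.orderOf_frobeniusAlgEquivOfAlgebraic, Nat.gcd_eq_right hm]
  have hfix (a : l) : a ∈ fixedField H ↔ a ^ Nat.card k ^ m = a := by
    rw [mem_fixedField_iff, ← hσ m]
    refine ⟨fun h => h _ (Subgroup.mem_zpowers _), fun h τ hτ => ?_⟩
    have h2 : σ ^ m ∈ MulAction.stabilizer Gal(l/k) a := h
    exact (Subgroup.zpowers_le.mpr h2) hτ
  have h1 := finrank_fixedField_eq_card H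
  rw [hH] at h1
  have h2 := Module.finrank_mul_finrank k (fixedField H) l
  have h3 : Module.finrank k (fixedField H) = m := by
    rw [h1] at h2
    obtain ⟨c, hc⟩ := hm
    rw [hc, Nat.mul_div_cancel_left _ (Nat.pos_of_ne_zero hm0)] at h2
    have : 0 < c := Nat.pos_of_ne_zero (by rintro rfl; simp at hc; lia)
    exact Nat.eq_of_mul_eq_mul_right this h2
  rw [← Nat.card_congr (Equiv.subtypeEquivRight hfix)]
  exact (Module.natCard_eq_pow_finrank (K := k) (V := fixedField H)).trans (by rw [h3])

theorem natDegree_minpoly_dvd_iff {a : l} {m : ℕ} :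
    (minpoly k a).natDegree ∣ m ↔ a ^ Nat.card k ^ m = a := by
  rw [(minpoly.irreducible (Algebra.IsIntegral.isIntegral a)).natDegree_dvd_iff_dvd_X_pow_card_pow_sub_X,
    minpoly.dvd_iff]
  simp [sub_eq_zero]

theorem natDegree_minpoly_dvd_finrank (a : l) :
    (minpoly k a).natDegree ∣ Module.finrank k l := by
  rw [natDegree_minpoly_dvd_iff, ← Module.natCard_eq_pow_finrank, Nat.card_eq_fintype_card,
    FiniteField.pow_card]

theorem sum_card_natDegree_minpoly {m : ℕ} (hm : m ∣ Module.finrank k l) :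
    ∑ d ∈ m.divisors, #{a : l | (minpoly k a).natDegree = d} = Nat.card k ^ m := by
  classical
  have hl : 0 < Module.finrank k l := Module.finrank_pos
  have hm0 : m ≠ 0 := by rintro rfl; simp at hm; lia
  rw [← card_pow_card_pow_eq_self k l hm, Nat.card_eq_fintype_card, Fintype.card_subtype,
    card_eq_sum_card_fiberwise (f := fun a => (minpoly k a).natDegree) (t := m.divisors)]
  · refine sum_congr rfl fun d hd => congrArg card ?_
    ext a
    simp only [mem_filter, mem_univ, true_and, iff_and_self]
    rintro rfl
    exact (natDegree_minpoly_dvd_iff k l).mp (Nat.dvd_of_mem_divisors hd)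
  · intro a ha
    simp only [coe_filter, mem_univ, true_and, Set.mem_ofPred_eq] at ha
    simpa [hm0] using (natDegree_minpoly_dvd_iff k l).mpr ha

theorem card_generators_eq_mobiusSum :
    (#{a : l | (minpoly k a).natDegree = Module.finrank k l} : ℝ) =
      mobiusSum (Nat.card k) (Module.finrank k l) * (Nat.card k : ℝ) ^ Module.finrank k l := by
  set f := Module.finrank k l with hf
  have hl : 0 < f := Module.finrank_pos
  have hq : (Nat.card k : ℝ) ≠ 0 := by exact_mod_cast Nat.card_pos.ne'
  -- The count over divisors is known only for m dividing f, so Möbius inversion is applied on that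
  -- divisor-closed set.
  have h := (ArithmeticFunction.sum_eq_iff_sum_mul_moebius_eq_on (R := ℝ)
    (f := fun d => (#{a : l | (minpoly k a).natDegree = d} : ℝ))
    (g := fun d => (Nat.card k : ℝ) ^ d) {d | d ∣ f} (fun m n hmn hn => hmn.trans hn)).mp
    (fun m _ hm => by exact_mod_cast sum_card_natDegree_minpoly k l hm) f hl dvd_rfl
  rw [← h, mobiusSum, sum_mul,
    Nat.sum_divisorsAntidiagonal' (f := fun x y =>
      (ArithmeticFunction.moebius x : ℝ) * (Nat.card k : ℝ) ^ y)]
  refine sum_congr rfl fun m _ => ?_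
  rw [zpow_sub₀ hq, zpow_natCast, zpow_natCast]
  field_simp

/-- At most q^d elements have degree d, each contributing q^d. Degrees other than f are proper
divisors of f, hence at most f/2, so a geometric series in q² gives the bound. This controls all
nongenerating residue classes together. -/
theorem sum_pow_natDegree_minpoly_le :
    ∑ a : l with (minpoly k a).natDegree ≠ Module.finrank k l,
      Nat.card k ^ (minpoly k a).natDegree ≤ 2 * Nat.card k ^ Module.finrank k l := by
  classical
  set f := Module.finrank k l with hf
  have hl : 0 < f := Module.finrank_pos
  set q := Nat.card k with hq
  have hq2 : 2 ≤ q := Finite.one_lt_card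
  have hgeom (N : ℕ) : ∑ d ∈ range (N + 1), (q ^ 2) ^ d ≤ 2 * (q ^ 2) ^ N := by
    induction N with
    | zero => simp
    | succ N ih =>
      rw [sum_range_succ]
      have : 2 ≤ q ^ 2 := by nlinarith
      have h4 : 2 * (q ^ 2) ^ N ≤ (q ^ 2) ^ (N + 1) := by
        rw [pow_succ' (q ^ 2)]
        exact Nat.mul_le_mul_right _ this
      lia
  have hmaps : ∀ a ∈ ({a | (minpoly k a).natDegree ≠ f} : Finset l),
      (minpoly k a).natDegree ∈ f.properDivisors := by
    intro a ha
    have h1 := natDegree_minpoly_dvd_finrank k l a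
    simp only [mem_filter, mem_univ, true_and] at ha
    exact Nat.mem_properDivisors.mpr ⟨h1, lt_of_le_of_ne (Nat.le_of_dvd hl h1) ha⟩
  rw [← sum_fiberwise_of_maps_to hmaps]
  calc _ ≤ ∑ d ∈ f.properDivisors, (q ^ 2) ^ d := by
        refine sum_le_sum fun d hd => ?_
        have hd' := (Nat.mem_properDivisors.mp hd).1
        have hd0 : d ≠ 0 := (Nat.pos_of_dvd_of_pos hd' hl).ne'
        have h1 : #{a : l | (minpoly k a).natDegree = d} ≤ q ^ d := by
          rw [hq, ← sum_card_natDegree_minpoly k l hd']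
          exact single_le_sum (f := fun d => #{a : l | (minpoly k a).natDegree = d})
            (fun _ _ => Nat.zero_le _) (Nat.mem_divisors_self d hd0)
        calc _ ≤ ∑ a : l with (minpoly k a).natDegree = d, q ^ (minpoly k a).natDegree := by
              refine sum_le_sum_of_subset fun a ha => ?_
              simp only [mem_filter, mem_univ, true_and] at ha ⊢
              exact ha.2
          _ = #{a : l | (minpoly k a).natDegree = d} * q ^ d := by
              rw [← smul_eq_mul, ← sum_const]
              refine sum_congr rfl fun a ha => ?_
              simp only [mem_filter, mem_univ, true_and] at ha
              rw [ha]
          _ ≤ q ^ d * q ^ d := by gcongr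
          _ = (q ^ 2) ^ d := by ring
    _ ≤ ∑ d ∈ range (f / 2 + 1), (q ^ 2) ^ d := by
        refine sum_le_sum_of_subset fun d hd => ?_
        obtain ⟨⟨c, hc⟩, h2⟩ := Nat.mem_properDivisors.mp hd
        have : 2 ≤ c := by
          by_contra! h
          interval_cases c <;> lia
        rw [mem_range, Nat.lt_succ_iff, Nat.le_div_iff_mul_le two_pos, hc]
        gcongr
    _ ≤ 2 * (q ^ 2) ^ (f / 2) := hgeom _
    _ ≤ 2 * q ^ f := by
        rw [← pow_mul]
        gcongr
        · lia
        · exact Nat.mul_div_le f 2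

/-- The sum is the proportion of elements of l that generate l over k. -/
theorem mobiusSum_nonneg_and_le_one :
    0 ≤ mobiusSum (Nat.card k) (Module.finrank k l) ∧
      mobiusSum (Nat.card k) (Module.finrank k l) ≤ 1 := by
  have h := card_generators_eq_mobiusSum k l
  have hq : (0 : ℝ) < (Nat.card k : ℝ) ^ Module.finrank k l := by
    have : 0 < Nat.card k := Nat.card_pos
    positivity
  have h1 : (#{a : l | (minpoly k a).natDegree = Module.finrank k l} : ℝ) ≤
      (Nat.card k : ℝ) ^ Module.finrank k l := by
    have := card_le_univ ({a : l | (minpoly k a).natDegree = Module.finrank k l} : Finset l)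
    rw [← Nat.card_eq_fintype_card, Module.natCard_eq_pow_finrank (K := k)] at this
    exact_mod_cast this
  constructor
  · refine nonneg_of_mul_nonneg_left (b := (Nat.card k : ℝ) ^ Module.finrank k l) ?_ hq
    rw [← h]
    positivity
  · rw [h] at h1
    exact le_of_mul_le_mul_right (by linarith) hq

end FiniteField

end PadicRoots

namespace PadicRoots

open IsLocalRing Metric Polynomial

/-! ### The orders 𝒪_F[x] and their indices -/

section Order

variable (F : Type*) [NontriviallyNormedField F] [IsUltrametricDist F]
  {K : Type*} [NormedField K] [IsUltrametricDist K] [NormedAlgebra F K]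

theorem residue_algebraMap_integers (c : integers F) :
    residue (integers K) (algebraMap (integers F) (integers K) c) =
      algebraMap (ResidueField (integers F)) (ResidueField (integers K)) (residue _ c) :=
  rfl

open IntermediateField in
theorem residue_mem_adjoin {x y : integers K} (hy : y ∈ Algebra.adjoin (integers F) {x}) :
    residue (integers K) y ∈ (ResidueField (integers F))⟮residue (integers K) x⟯ := by
  induction hy using Algebra.adjoin_induction with
  | mem z hz =>
    rw [Set.mem_singleton_iff] at hz
    rw [hz]
    exact mem_adjoin_simple_self _ _
  | algebraMap c =>
    rw [residue_algebraMap_integers]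
    exact IntermediateField.algebraMap_mem _ _
  | add y z _ _ hy hz => rw [map_add]; exact add_mem hy hz
  | mul y z _ _ hy hz => rw [map_mul]; exact mul_mem hy hz

theorem coe_mem_adjoin {x y : integers K} (hy : y ∈ Algebra.adjoin (integers F) {x}) :
    (y : K) ∈ Algebra.adjoin F {(x : K)} := by
  induction hy using Algebra.adjoin_induction with
  | mem z hz =>
    rw [Set.mem_singleton_iff] at hz
    rw [hz]
    exact Algebra.self_mem_adjoin_singleton _ _
  | algebraMap c => exact algebraMap_mem _ (c : F)
  | add y z _ _ hy hz => exact add_mem hy hz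
  | mul y z _ _ hy hz => exact mul_mem hy hz

theorem exists_mem_adjoin_residue_eq (x : integers K) {b : ResidueField (integers K)}
    (hb : b ∈ Algebra.adjoin (ResidueField (integers F)) {residue (integers K) x}) :
    ∃ y ∈ Algebra.adjoin (integers F) {x}, residue (integers K) y = b := by
  induction hb using Algebra.adjoin_induction with
  | mem z hz =>
    rw [Set.mem_singleton_iff] at hz
    exact ⟨x, Algebra.self_mem_adjoin_singleton _ _, hz.symm⟩
  | algebraMap c =>
    obtain ⟨c, rfl⟩ := residue_surjective c
    exact ⟨_, algebraMap_mem _ c, residue_algebraMap_integers F c⟩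
  | add y z _ _ hy hz =>
    obtain ⟨y', hy', rfl⟩ := hy
    obtain ⟨z', hz', rfl⟩ := hz
    exact ⟨_, add_mem hy' hz', map_add _ _ _⟩
  | mul y z _ _ hy hz =>
    obtain ⟨y', hy', rfl⟩ := hy
    obtain ⟨z', hz', rfl⟩ := hz
    exact ⟨_, mul_mem hy' hz', map_mul _ _ _⟩

theorem orderIndex_eq_one {x : integers K} (h : Algebra.adjoin (integers F) {x} = ⊤) :
    orderIndex F x = 1 := by
  have : Subsingleton (integers K ⧸ Subalgebra.toSubmodule (Algebra.adjoin (integers F) {x})) := by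
    rw [Submodule.Quotient.subsingleton_iff, h]
    exact Algebra.top_toSubmodule
  exact Nat.card_unique

variable [ProperSpace F] [FiniteDimensional F K]

open IntermediateField in
theorem adjoin_residue_eq_top {x : integers K}
    (hx : (minpoly (ResidueField (integers F)) (residue (integers K) x)).natDegree =
      residueDegree F K) :
    Algebra.adjoin (ResidueField (integers F)) {residue (integers K) x} = ⊤ := by
  have := finite_residueField_ext F K
  have hint : IsIntegral (ResidueField (integers F)) (residue (integers K) x) :=
    Algebra.IsIntegral.isIntegral _
  rw [← adjoin_simple_toSubalgebra_of_isAlgebraic hint.isAlgebraic, ← top_toSubalgebra]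
  congr 1
  refine eq_of_le_of_finrank_eq le_top ?_
  rw [adjoin.finrank hint, hx, finrank_top']
  rfl

open IntermediateField in
/-- The index of `𝒪_F[x]` is infinite or at least the index of its image in the residue field. -/
theorem orderIndex_lower_bound (x : integers K) : orderIndex F x = 0 ∨
    residueCard F ^ residueDegree F K ≤ orderIndex F x * residueCard F ^
      (minpoly (ResidueField (integers F)) (residue (integers K) x)).natDegree := by
  refine or_iff_not_imp_left.mpr fun h0 => ?_
  have := finite_residueField_ext F K
  let A := Subalgebra.toSubmodule (Algebra.adjoin (integers F) {x})
  let E := (ResidueField (integers F))⟮residue (integers K) x⟯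
  have hfin : Finite (integers K ⧸ A) := Nat.finite_of_card_ne_zero h0
  -- Only surjectivity matters, so representatives may be chosen arbitrarily: two of them differ by
  -- an element of A, whose residue lies in E.
  let g : integers K ⧸ A → ResidueField (integers K) ⧸ E.toSubalgebra.toSubmodule :=
    fun z => Submodule.Quotient.mk (residue (integers K) (Quotient.out z))
  have hg : Function.Surjective g := by
    intro w
    obtain ⟨b, rfl⟩ := Submodule.Quotient.mk_surjective _ w
    obtain ⟨y, rfl⟩ := residue_surjective b
    refine ⟨Submodule.Quotient.mk y, ?_⟩
    have h1 : Submodule.Quotient.mk (p := A) (Quotient.out (Submodule.Quotient.mk (p := A) y)) =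
        Submodule.Quotient.mk y := Quotient.out_eq _
    rw [Submodule.Quotient.eq] at h1
    refine (Submodule.Quotient.eq _).mpr ?_
    rw [← map_sub]
    exact residue_mem_adjoin F h1
  have h1 := Nat.card_le_card_of_surjective g hg
  have h2 := Submodule.card_eq_card_quotient_mul_card E.toSubalgebra.toSubmodule
  have hE : Nat.card E.toSubalgebra.toSubmodule = residueCard F ^
      (minpoly (ResidueField (integers F)) (residue (integers K) x)).natDegree := by
    rw [← adjoin.finrank (K := ResidueField (integers F)) (Algebra.IsIntegral.isIntegral _)]
    exact Module.natCard_eq_pow_finrank (K := ResidueField (integers F)) (V := E)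
  rw [hE, residueCard_ext F K] at h2
  rw [h2, mul_comm]
  gcongr
  exact h1

/-- Nakayama's lemma over 𝒪_F: the hypothesis says B ⊆ A + πB, and B is a finitely generated module
because 𝒪_K is Noetherian over 𝒪_F. -/
theorem adjoin_le_of_le_sup [CharZero F] {π : F} (hπ : IsUniformizer π)
    {A B : Subalgebra (integers F) (integers K)}
    (h : ∀ y ∈ B, ∃ u ∈ A, ∃ v ∈ B, (y : K) = u + π • (v : K)) : B ≤ A := by
  have := isPrincipalIdealRing_integers F
  have := finite_integers F K
  have hN : IsNoetherian (integers F) (integers K) := inferInstance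
  have key := Submodule.le_of_le_smul_of_le_jacobson_bot (I := maximalIdeal (integers F))
    (N := A.toSubmodule) (N' := B.toSubmodule) (IsNoetherian.noetherian _)
    (maximalIdeal_le_jacobson _) ?_
  · exact key
  · intro y hy
    obtain ⟨u, hu, v, hv, huv⟩ := h y hy
    let π' : integers F := ⟨π, mem_integers.mpr hπ.norm_lt_one.le⟩
    have hy' : y = u + π' • v := by
      ext
      rw [huv]
      exact congrArg _ (coe_smul_integers F K π' v).symm
    rw [hy']
    refine add_mem (Submodule.mem_sup_left hu) (Submodule.mem_sup_right ?_)
    refine Submodule.smul_mem_smul ?_ hv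
    rw [← residue_eq_zero_iff, residue_eq_zero]
    exact hπ.norm_lt_one

theorem adjoin_eq_top_of_integers [CharZero F] {x : integers K}
    (h : Algebra.adjoin (integers F) {x} = ⊤) : Algebra.adjoin F {(x : K)} = ⊤ := by
  rw [eq_top_iff]
  intro y _
  rw [← (integralBasis F K).sum_repr y]
  refine sum_mem fun i _ => Subalgebra.smul_mem _ ?_ _
  rw [integralBasis_apply]
  exact coe_mem_adjoin F (by rw [h]; trivial)

/-- If `x` generates `K / F`, then `𝒪_F[x]` contains a nonzero multiple of `𝒪_K`. -/
theorem exists_smul_mem_adjoin {x : integers K} (hx : Algebra.adjoin F {(x : K)} = ⊤) :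
    ∃ c : F, c ≠ 0 ∧ ∀ z : K, ‖z‖ ≤ 1 → ∃ y ∈ Algebra.adjoin (integers F) {x}, (y : K) = c • z := by
  have := properSpace_ext F K
  let pb := PowerBasis.ofAdjoinEqTop (Algebra.IsIntegral.isIntegral (R := F) (x : K)) hx
  have hgen : pb.gen = (x : K) := PowerBasis.ofAdjoinEqTop_gen _ _
  -- Coordinates in the power basis are continuous, hence bounded on the compact unit ball; a small
  -- enough c then makes all of them integral.
  have hbd (i : Fin pb.dim) : ∃ M : ℝ, ∀ z : K, ‖z‖ ≤ 1 → ‖pb.basis.repr z i‖ ≤ M := by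
    have hcont : Continuous (pb.basis.coord i) := LinearMap.continuous_of_finiteDimensional _
    obtain ⟨M, hM⟩ := (isCompact_closedBall (0 : K) 1).exists_bound_of_continuousOn
      hcont.continuousOn
    exact ⟨M, fun z hz => hM z (by simpa using hz)⟩
  choose M hM using hbd
  obtain ⟨N, hN⟩ := Finite.exists_le M
  obtain ⟨c, hc0, hc⟩ := NormedField.exists_norm_lt F (r := (max N 1)⁻¹) (by positivity)
  have hc' : ‖c‖ * N ≤ 1 := by
    have h1 : (0 : ℝ) < max N 1 := by positivity
    calc ‖c‖ * N ≤ ‖c‖ * max N 1 := by gcongr; exact le_max_left N 1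
      _ ≤ (max N 1)⁻¹ * max N 1 := by gcongr
      _ = 1 := inv_mul_cancel₀ h1.ne'
  refine ⟨c, norm_pos_iff.mp hc0, fun z hz => ?_⟩
  have hint (i : Fin pb.dim) : ‖c * pb.basis.repr z i‖ ≤ 1 := by
    rw [norm_mul]
    exact (mul_le_mul_of_nonneg_left ((hM i z hz).trans (hN i)) (norm_nonneg _)).trans hc'
  refine ⟨∑ i, (⟨c * pb.basis.repr z i, mem_integers.mpr (hint i)⟩ : integers F) • x ^ (i : ℕ),
    sum_mem fun i _ => Subalgebra.smul_mem _
      (pow_mem (Algebra.self_mem_adjoin_singleton _ _) _) _, ?_⟩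
  conv_rhs => rw [← pb.basis.sum_repr z, Finset.smul_sum]
  rw [ AddSubmonoidClass.coe_finsetSum]
  refine Finset.sum_congr rfl fun i _ => ?_
  rw [coe_smul_integers, pb.basis_eq_pow, hgen, smul_smul]
  rfl

/-- For x close enough to x₀, x = x₀ + πw with w in 𝒪_F[x₀]. Then 𝒪_F[x] ⊆ 𝒪_F[x₀] ⊆ 𝒪_F[x] +
π𝒪_F[x₀], and Nakayama gives equality. So the index is locally constant on generators, which is what
makes the density measurable. -/
theorem exists_adjoin_eq_of_near [CharZero F] {x₀ : integers K}
    (hx₀ : Algebra.adjoin F {(x₀ : K)} = ⊤) :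
    ∃ δ > 0, ∀ x : integers K, ‖(x : K) - x₀‖ < δ →
      Algebra.adjoin (integers F) {x} = Algebra.adjoin (integers F) {x₀} ∧
      Algebra.adjoin F {(x : K)} = ⊤ := by
  obtain ⟨c, hc, hcx⟩ := exists_smul_mem_adjoin F hx₀
  obtain ⟨π, hπ⟩ := exists_isUniformizer (K := F)
  have hcπ : 0 < ‖c * π‖ := norm_pos_iff.mpr (mul_ne_zero hc hπ.ne_zero)
  refine ⟨‖c * π‖, hcπ, fun x hx => ?_⟩
  obtain ⟨w, hw, hw'⟩ := hcx ((c * π)⁻¹ • ((x : K) - x₀)) (by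
    rw [norm_smul, norm_inv]
    exact (inv_mul_le_one₀ hcπ).mpr hx.le)
  have hxw : (x : K) = x₀ + π • (w : K) := by
    rw [hw', smul_smul, smul_smul, mul_comm π c, mul_inv_cancel₀ (norm_pos_iff.mp hcπ), one_smul]
    ring
  let π' : integers F := ⟨π, mem_integers.mpr hπ.norm_lt_one.le⟩
  have hxw' : x = x₀ + π' • w := by
    ext
    rw [hxw]
    exact congrArg _ (coe_smul_integers F K π' w).symm
  have hle : Algebra.adjoin (integers F) {x} ≤ Algebra.adjoin (integers F) {x₀} := by
    rw [Algebra.adjoin_le_iff, Set.singleton_subset_iff, SetLike.mem_coe, hxw']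
    exact add_mem (Algebra.self_mem_adjoin_singleton _ _) (Subalgebra.smul_mem _ hw _)
  have heq : Algebra.adjoin (integers F) {x} = Algebra.adjoin (integers F) {x₀} := by
    refine le_antisymm hle (adjoin_le_of_le_sup F hπ fun y hy => ?_)
    suffices h : ∃ u ∈ Algebra.adjoin (integers F) {x}, ∃ v ∈ Algebra.adjoin (integers F) {x₀},
        y = u + π' • v by
      obtain ⟨u, hu, v, hv, rfl⟩ := h
      exact ⟨u, hu, v, hv, congrArg _ (coe_smul_integers F K π' v)⟩
    induction hy using Algebra.adjoin_induction with
    | mem z hz =>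
      rw [Set.mem_singleton_iff] at hz
      refine ⟨x, Algebra.self_mem_adjoin_singleton _ _, -w, neg_mem hw, ?_⟩
      rw [hz, hxw', smul_neg, add_neg_cancel_right]
    | algebraMap a => exact ⟨_, algebraMap_mem _ a, 0, zero_mem _, by simp⟩
    | add y z _ _ hy hz =>
      obtain ⟨u, hu, v, hv, rfl⟩ := hy
      obtain ⟨u', hu', v', hv', rfl⟩ := hz
      exact ⟨u + u', add_mem hu hu', v + v', add_mem hv hv', by rw [smul_add]; ring⟩
    | mul y z _ _ hy hz =>
      obtain ⟨u, hu, v, hv, rfl⟩ := hy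
      obtain ⟨u', hu', v', hv', rfl⟩ := hz
      refine ⟨u * u', mul_mem hu hu', u * v' + v * u' + π' • (v * v'),
        add_mem (add_mem (mul_mem (hle hu) hv') (mul_mem hv (hle hu')))
          (Subalgebra.smul_mem _ (mul_mem hv hv') _), ?_⟩
      simp only [Algebra.smul_def]
      ring
  refine ⟨heq, ?_⟩
  rw [eq_top_iff, ← hx₀, Algebra.adjoin_le_iff, Set.singleton_subset_iff, SetLike.mem_coe]
  refine coe_mem_adjoin F ?_
  rw [heq]
  exact Algebra.self_mem_adjoin_singleton _ _

end Order

/-! ### Most elements of a generating residue class generate 𝒪_K -/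

section Generic

variable (F : Type*) [NontriviallyNormedField F] [IsUltrametricDist F] [ProperSpace F] [CharZero F]
  {K : Type*} [NontriviallyNormedField K] [IsUltrametricDist K] [NormedAlgebra F K]
  [FiniteDimensional F K]

/-- Every integer can be approximated by elements of 𝒪_F[x] modulo successive powers of ϖ. At the
ramification index e the remainder lies in π𝒪_K, and Nakayama finishes. -/
theorem adjoin_eq_top_of_uniformizer {x ϖ : integers K} (hϖ : IsUniformizer (ϖ : K))
    (hϖx : ϖ ∈ Algebra.adjoin (integers F) {x})
    (hx : Algebra.adjoin (ResidueField (integers F)) {residue (integers K) x} = ⊤) :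
    Algebra.adjoin (integers F) {x} = ⊤ := by
  obtain ⟨π, hπ⟩ := exists_isUniformizer (K := F)
  have happrox (j : ℕ) : ∀ z : integers K, ∃ y ∈ Algebra.adjoin (integers F) {x},
      ∃ w : integers K, z = y + ϖ ^ j * w := by
    induction j with
    | zero => exact fun z => ⟨0, zero_mem _, z, by simp⟩
    | succ j ih =>
      intro z
      obtain ⟨y, hy, w, rfl⟩ := ih z
      obtain ⟨u, hu, huw⟩ := exists_mem_adjoin_residue_eq F x
        (b := residue (integers K) w) (by rw [hx]; trivial)
      have h1 := hϖ.norm_le (residue_eq_residue.mp huw.symm)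
      have h2 : ‖((w : K) - u) / ϖ‖ ≤ 1 := by
        rw [norm_div]
        exact div_le_one_of_le₀ h1 (norm_nonneg _)
      refine ⟨y + ϖ ^ j * u, add_mem hy (mul_mem (pow_mem hϖx _) hu),
        ⟨((w : K) - u) / ϖ, mem_integers.mpr h2⟩, ?_⟩
      ext
      have := hϖ.ne_zero
      push_cast
      field_simp
      ring
  obtain ⟨e, -, he, -⟩ := exists_ramification F K hπ hϖ
  rw [eq_top_iff]
  refine adjoin_le_of_le_sup F hπ fun z _ => ?_
  obtain ⟨y, hy, w, rfl⟩ := happrox e z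
  have h2 : ‖π⁻¹ • ((ϖ : K) ^ e * w)‖ ≤ 1 := by
    rw [norm_smul, norm_mul, norm_pow, ← he, norm_inv, ← mul_assoc,
      inv_mul_cancel₀ hπ.norm_pos.ne', one_mul]
    exact norm_coe_le_one _
  refine ⟨y, hy, ⟨_, mem_integers.mpr h2⟩, trivial, ?_⟩
  rw [smul_smul, mul_inv_cancel₀ hπ.ne_zero, one_smul]
  push_cast
  rfl

/-- In the residue class of a generator of the residue field extension, all elements outside a
ball of radius `‖ϖ‖ ^ 2` generate `𝒪_K` over `𝒪_F`. -/
theorem exists_forall_adjoin_eq_top {ϖ : K} (hϖ : IsUniformizer ϖ)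
    {a : ResidueField (integers K)}
    (ha : (minpoly (ResidueField (integers F)) a).natDegree = residueDegree F K) :
    ∃ x₀ : K, ∀ x : integers K, residue (integers K) x = a → ‖ϖ‖ ^ 2 < ‖(x : K) - x₀‖ →
      Algebra.adjoin (integers F) {x} = ⊤ := by
  have := finite_residueField (K := F)
  have := finite_residueField_ext F K
  obtain ⟨φ, hφ⟩ := Polynomial.map_surjective _ residue_surjective
    (minpoly (ResidueField (integers F)) a)
  have hres (ψ : (integers F)[X]) (x : integers K) (hx : residue (integers K) x = a) :
      residue (integers K) (aeval x ψ) = aeval a (ψ.map (residue (integers F))) := by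
    rw [← hx, aeval_def, hom_eval₂, aeval_def, eval₂_map]
    rfl
  -- The value φ(x) reduces to 0. If its norm is exactly ‖ϖ‖, it is a uniformizer inside 𝒪_F[x];
  -- otherwise its norm is at most ‖ϖ‖².
  have hunif (x : integers K) (hx : residue (integers K) x = a) :
      Algebra.adjoin (integers F) {x} = ⊤ ∨ ‖(aeval x φ : integers K).1‖ ≤ ‖ϖ‖ ^ 2 := by
    have h1 : ‖(aeval x φ : integers K).1‖ < 1 := by
      rw [← residue_eq_zero, hres φ x hx, hφ, minpoly.aeval]
    by_cases h : ‖(aeval x φ : integers K).1‖ = ‖ϖ‖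
    · left
      refine adjoin_eq_top_of_uniformizer F (ϖ := aeval x φ) ⟨h ▸ hϖ.norm_pos, h1, ?_⟩
        (aeval_mem_adjoin_singleton _ _) (adjoin_residue_eq_top F (by rw [hx, ha]))
      intro y hy
      rw [h]
      exact hϖ.norm_le hy
    · right
      have h2 : ‖(aeval x φ : integers K).1 / ϖ‖ < 1 := by
        rw [norm_div, div_lt_one hϖ.norm_pos]
        exact lt_of_le_of_ne (hϖ.norm_le h1) h
      have h3 := hϖ.norm_le h2
      rw [norm_div, div_le_iff₀ hϖ.norm_pos] at h3
      rwa [sq]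
  -- Center the ball at one exceptional x₀. For another exceptional x, the expansion φ(x) - φ(x₀) =
  -- φ'(x₀)δ + cδ², with φ'(x₀) a unit by separability, forces ‖δ‖ ≤ ‖ϖ‖². With no exceptional
  -- element any center works.
  by_cases hex : ∃ x₀ : integers K, residue (integers K) x₀ = a ∧
      ‖(aeval x₀ φ : integers K).1‖ ≤ ‖ϖ‖ ^ 2
  · obtain ⟨x₀, hx₀, hφ₀⟩ := hex
    refine ⟨x₀, fun x hx hlt => (hunif x hx).resolve_right fun hφx => hlt.not_ge ?_⟩
    set δ : integers K := x - x₀ with hδ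
    have hδ1 : ‖(δ : K)‖ ≤ ‖ϖ‖ := hϖ.norm_le (residue_eq_residue.mp (hx.trans hx₀.symm))
    obtain ⟨c, hc⟩ := Polynomial.binomExpansion (φ.map (algebraMap (integers F) (integers K))) x₀ δ
    rw [show x₀ + δ = x by rw [hδ]; ring, derivative_map, eval_map_algebraMap,
      eval_map_algebraMap, eval_map_algebraMap] at hc
    have hder : ‖(aeval x₀ (derivative φ) : integers K).1‖ = 1 := by
      refine le_antisymm (norm_coe_le_one _) (not_lt.mp fun h => ?_)
      rw [← residue_eq_zero, hres _ x₀ hx₀, ← derivative_map, hφ] at h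
      have hsep : (minpoly (ResidueField (integers F)) a).Separable :=
        PerfectField.separable_of_irreducible
          (minpoly.irreducible (Algebra.IsIntegral.isIntegral a))
      exact hsep.aeval_derivative_ne_zero (minpoly.aeval _ _) h
    have h1 : (aeval x₀ (derivative φ) : integers K).1 * (δ : K) =
        ((aeval x φ : integers K).1 - (aeval x₀ φ : integers K).1) - c.1 * (δ : K) ^ 2 := by
      rw [hc]
      push_cast
      ring
    have h2 := congrArg norm h1
    rw [norm_mul, hder, one_mul] at h2
    calc ‖(x : K) - x₀‖ = ‖(δ : K)‖ := rfl
      _ ≤ ‖ϖ‖ ^ 2 := by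
        rw [h2]
        refine (norm_sub_le_max _ _).trans (max_le ?_ ?_)
        · exact (norm_sub_le_max _ _).trans (max_le hφx hφ₀)
        · rw [norm_mul, norm_pow]
          calc ‖c.1‖ * ‖(δ : K)‖ ^ 2 ≤ 1 * ‖ϖ‖ ^ 2 := by
                gcongr
                exact norm_coe_le_one c
            _ = _ := one_mul _
  · push Not at hex
    exact ⟨0, fun x hx _ => (hunif x hx).resolve_right (hex x hx).not_ge⟩

end Generic

end PadicRoots

namespace PadicRoots

open IsLocalRing Metric
open scoped ENNReal

/-! ### Integrals over polynomials -/

section Nrm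

variable (p : ℕ) [Fact p.Prime] (F : Type*) [NontriviallyNormedField F] [NormedAlgebra ℚ_[p] F]
  {K : Type*} [NormedField K]

variable (K) in
theorem continuous_nrm : Continuous fun x : K => nrm p F x := by
  unfold nrm
  fun_prop

theorem nrm_nonneg (x : K) : 0 ≤ nrm p F x := by
  unfold nrm
  positivity

theorem nrm_le_one {x : K} (hx : ‖x‖ ≤ 1) : nrm p F x ≤ 1 :=
  pow_le_one₀ (norm_nonneg _) hx

end Nrm

theorem sum_smul_pow_zero {F K : Type*} [Field F] [Field K]
    [Algebra F K] (c : Fin (0 + 1) → F) (x : K) :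
    ∑ i, c i • x ^ (i : ℕ) = algebraMap F K (c 0) := by
  rw [Algebra.algebraMap_eq_smul_one]
  simp

section Coeff

variable (F : Type*) [NontriviallyNormedField F] [IsUltrametricDist F]

/-- The coefficient vectors of polynomials of degree at most `m` over `𝒪_F`. -/
def coeffBox (m : ℕ) : Set (Fin (m + 1) → F) := {c | ∀ i, c i ∈ integers F}

theorem coeffBox_eq_pi (m : ℕ) : coeffBox F m = Set.univ.pi fun _ => closedBall (0 : F) 1 := by
  ext c
  simp only [coeffBox, Set.mem_pi, Set.mem_univ, true_imp_iff, mem_closedBall_zero_iff]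
  exact forall_congr' fun i => mem_integers

theorem isCompact_coeffBox [ProperSpace F] (m : ℕ) : IsCompact (coeffBox F m) := by
  rw [coeffBox_eq_pi]
  exact isCompact_univ_pi fun _ => isCompact_closedBall _ _

variable {K : Type*} [NormedField K] [NormedAlgebra F K] [IsUltrametricDist K]

theorem norm_sum_smul_pow_le {m : ℕ} {x : K} (hx : ‖x‖ ≤ 1)
    {c : Fin (m + 1) → F} (hc : c ∈ coeffBox F m) : ‖∑ i, c i • x ^ (i : ℕ)‖ ≤ 1 := by
  refine IsUltrametricDist.norm_sum_le_of_forall_le_of_nonneg zero_le_one fun i _ => ?_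
  rw [norm_smul, norm_pow]
  exact mul_le_one₀ (mem_integers.mp (hc i)) (by positivity) (pow_le_one₀ (norm_nonneg _) hx)

/-- The powers of the residue of x below f form a basis of the residue extension, and m + 1 ≥ f
coefficients are available. -/
theorem exists_coeff_residue_eq [ProperSpace F] [FiniteDimensional F K] {m : ℕ}
    (hm : residueDegree F K ≤ m + 1) {x : integers K}
    (hx : (minpoly (ResidueField (integers F)) (residue (integers K) x)).natDegree =
      residueDegree F K) (b : ResidueField (integers K)) :
    ∃ t : Fin (m + 1) → integers F,
      residue (integers K) (∑ i, algebraMap (integers F) (integers K) (t i) * x ^ (i : ℕ)) = b := by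
  have := finite_residueField_ext F K
  let pb := PowerBasis.ofAdjoinEqTop (Algebra.IsIntegral.isIntegral _) (adjoin_residue_eq_top F hx)
  have hgen : pb.gen = residue (integers K) x := PowerBasis.ofAdjoinEqTop_gen _ _
  obtain ⟨P, hP, hPb⟩ := pb.exists_eq_aeval b
  have hdim : P.natDegree < m + 1 := by
    rw [← pb.natDegree_minpoly, hgen, hx] at hP
    lia
  choose t ht using residue_surjective (R := integers F)
  refine ⟨fun i => t (P.coeff i), ?_⟩
  rw [hPb, Polynomial.aeval_eq_sum_range' hdim, Finset.sum_range, map_sum, hgen]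
  refine Finset.sum_congr rfl fun i _ => ?_
  rw [map_mul, map_pow, residue_algebraMap_integers, ht, Algebra.smul_def]

end Coeff

section PolyIntegral

variable (p : ℕ) [Fact p.Prime] (F : Type*) [NontriviallyNormedField F] [NormedAlgebra ℚ_[p] F]
  [IsUltrametricDist F] [ProperSpace F] [MeasurableSpace F] [BorelSpace F]

theorem measure_coeffBox (m : ℕ) : Measure.pi (fun _ => haar F) (coeffBox F m) = 1 := by
  rw [coeffBox_eq_pi, Measure.pi_pi]
  simp [haar_closedBall_one]

variable {K : Type*} [NormedField K] [NormedAlgebra F K]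

theorem continuous_polyIntegral [ProperSpace K] (m : ℕ) :
    Continuous fun x : K => polyIntegral p F m x := by
  refine continuous_parametric_integral_of_continuous
    (f := fun (x : K) (c : Fin (m + 1) → F) =>
      nrm p F (∑ i, c i • x ^ (i : ℕ)) ^ Module.finrank F K) ?_ (isCompact_coeffBox F m)
  refine ((continuous_nrm p F K).comp ?_).pow _
  fun_prop

theorem polyIntegral_nonneg (m : ℕ) (x : K) : 0 ≤ polyIntegral p F m x :=
  integral_nonneg fun _ => pow_nonneg (nrm_nonneg p F _) _

/-- The coefficient vectors of the polynomials `Q` over `𝒪_F` with `‖Q(x)‖ < 1`. -/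
def smallValueSet (m : ℕ) (x : K) : Set (Fin (m + 1) → F) :=
  {c ∈ coeffBox F m | ‖∑ i, c i • x ^ (i : ℕ)‖ < 1}

theorem measurableSet_smallValueSet (m : ℕ) (x : K) :
    MeasurableSet (smallValueSet F m x) := by
  refine (isCompact_coeffBox F m).measurableSet.inter ?_
  have h : Continuous fun c : Fin (m + 1) → F => ‖∑ i, c i • x ^ (i : ℕ)‖ := by fun_prop
  exact (isOpen_lt h continuous_const).measurableSet

/-- The integrand of `polyIntegral` is `1` off `smallValueSet`; bound it by `s` there. -/
theorem polyIntegral_bounds [IsUltrametricDist K] (m : ℕ) {x : K} (hx : ‖x‖ ≤ 1) {s : ℝ}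
    (hs : ∀ c ∈ smallValueSet F m x,
      nrm p F (∑ i, c i • x ^ (i : ℕ)) ^ Module.finrank F K ≤ s) :
    1 - (Measure.pi fun _ => haar F).real (smallValueSet F m x) ≤ polyIntegral p F m x ∧
    polyIntegral p F m x ≤ 1 - (Measure.pi fun _ => haar F).real (smallValueSet F m x) +
      s * (Measure.pi fun _ => haar F).real (smallValueSet F m x) := by
  set μ : Measure (Fin (m + 1) → F) := Measure.pi fun _ => haar F
  set S := smallValueSet F m x
  set g : (Fin (m + 1) → F) → ℝ := fun c =>
    nrm p F (∑ i, c i • x ^ (i : ℕ)) ^ Module.finrank F K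
  have hSU : S ⊆ coeffBox F m := fun c hc => hc.1
  have hSm : MeasurableSet S := measurableSet_smallValueSet F m x
  have hUm : MeasurableSet (coeffBox F m) := (isCompact_coeffBox F m).measurableSet
  have hμU : μ (coeffBox F m) = 1 := measure_coeffBox F m
  have hμS : μ S ≠ ∞ := ((measure_mono hSU).trans_lt (by rw [hμU]; exact ENNReal.one_lt_top)).ne
  have hg : Continuous g := by
    refine ((continuous_nrm p F K).comp ?_).pow _
    fun_prop
  have hgi : IntegrableOn g (coeffBox F m) μ :=
    hg.continuousOn.integrableOn_compact (isCompact_coeffBox F m)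
  have h1 : ∫ c in coeffBox F m \ S, g c ∂μ = 1 - μ.real S := by
    have : ∀ c ∈ coeffBox F m \ S, g c = 1 := by
      intro c hc
      have : ‖∑ i, c i • x ^ (i : ℕ)‖ = 1 :=
        le_antisymm (norm_sum_smul_pow_le F hx hc.1) (not_lt.mp fun h => hc.2 ⟨hc.1, h⟩)
      simp [g, nrm, this]
    rw [setIntegral_congr_fun (hUm.diff hSm) this]
    simp only [integral_const, smul_eq_mul, mul_one, MeasurableSet.univ, measureReal_restrict_apply,
      Set.univ_inter]
    rw [measureReal_sdiff hSU hSm (by rw [hμU]; exact ENNReal.one_ne_top), measureReal_def, hμU, ENNReal.toReal_one]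
  have h2 : polyIntegral p F m x = (∫ c in S, g c ∂μ) + (1 - μ.real S) := by
    rw [← h1, ← setIntegral_union Set.disjoint_sdiff_right (hUm.diff hSm) (hgi.mono_set hSU)
      (hgi.mono_set Set.sdiff_subset), Set.union_sdiff_cancel hSU]
    rfl
  have h3 : 0 ≤ ∫ c in S, g c ∂μ := integral_nonneg fun _ => pow_nonneg (nrm_nonneg p F _) _
  have h4 : ∫ c in S, g c ∂μ ≤ s * μ.real S := by
    calc _ ≤ ∫ c in S, s ∂μ :=
          setIntegral_mono_on (hgi.mono_set hSU) (integrableOn_const hμS) hSm hs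
      _ = _ := by simp [mul_comm]
  constructor <;> linarith

theorem polyIntegral_le_one [IsUltrametricDist K] (m : ℕ) {x : K} (hx : ‖x‖ ≤ 1) :
    polyIntegral p F m x ≤ 1 := by
  have h := (polyIntegral_bounds p F m hx (s := 1) fun c hc =>
    pow_le_one₀ (nrm_nonneg p F _) (nrm_le_one p F hc.2.le)).2
  linarith

/-- Here the polynomials are constants: nonunits have measure 1/q, and on them the integrand is at
most q^(-r). -/
theorem polyIntegral_zero_bounds [CharZero F] [FiniteDimensional ℚ_[p] F] [IsUltrametricDist K]
    [FiniteDimensional F K] {x : K} (hx : ‖x‖ ≤ 1) :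
    1 - 1 / (residueCard F : ℝ) ≤ polyIntegral p F 0 x ∧
    polyIntegral p F 0 x ≤
      1 - 1 / (residueCard F : ℝ) + 1 / (residueCard F : ℝ) ^ Module.finrank F K := by
  obtain ⟨π, hπ⟩ := exists_isUniformizer (K := F)
  have hset : smallValueSet F 0 x = Set.univ.pi fun _ => ball (0 : F) 1 := by
    ext c
    simp only [smallValueSet, coeffBox, Set.mem_pi, Set.mem_univ, true_imp_iff,
      mem_ball_zero_iff, sum_smul_pow_zero, Set.mem_ofPred_eq, mem_integers, norm_algebraMap']
    refine ⟨fun h i => ?_, fun h => ⟨fun i => (h i).le, h 0⟩⟩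
    rw [Fin.fin_one_eq_zero i]
    exact h.2
  have hμ : (Measure.pi fun _ => haar F).real (smallValueSet F 0 x) = 1 / (residueCard F : ℝ) := by
    rw [measureReal_def, hset, Measure.pi_pi]
    simp [haar_ball_one, residueCard]
  have hq1 : (1 : ℝ) ≤ residueCard F := by exact_mod_cast residueCard_pos (K := F)
  have h := polyIntegral_bounds p F 0 hx (s := 1 / (residueCard F : ℝ) ^ Module.finrank F K) ?_
  · rw [hμ] at h
    refine ⟨h.1, h.2.trans ?_⟩
    gcongr
    exact mul_le_of_le_one_right (by positivity) (by rw [div_le_one (by linarith)]; exact hq1)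
  · intro c hc
    have h0 : ‖c 0‖ < 1 := by
      have := hc.2
      rwa [sum_smul_pow_zero, norm_algebraMap'] at this
    rw [sum_smul_pow_zero, one_div, ← inv_pow, nrm, norm_algebraMap', ← nrm_uniformizer_base p hπ]
    gcongr
    exact hπ.norm_le h0

/-- Translating the set where ‖Q(x)‖ < 1 by one polynomial for each residue value gives disjoint
subsets of a box of measure 1, as many as the residue field of K has elements. -/
theorem one_sub_le_polyIntegral [IsUltrametricDist K] [FiniteDimensional F K] {m : ℕ}
    (hm : residueDegree F K ≤ m + 1) {x : integers K}
    (hx : (minpoly (ResidueField (integers F)) (residue (integers K) x)).natDegree =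
      residueDegree F K) :
    1 - 1 / (Nat.card (ResidueField (integers K)) : ℝ) ≤ polyIntegral p F m (x : K) := by
  have := properSpace_ext F K
  have := finite_residueField (K := K)
  refine le_trans ?_ (polyIntegral_bounds p F m (norm_coe_le_one x) (s := 1) fun c hc =>
    pow_le_one₀ (nrm_nonneg p F _) (nrm_le_one p F hc.2.le)).1
  choose t ht using exists_coeff_residue_eq F hm hx
  have key := card_mul_measure_le (Measure.pi fun _ => haar F) (B := coeffBox F m)
    (measurableSet_smallValueSet F m (x : K)) (fun b i => (t b i : F)) ?_ ?_
  · rw [measure_coeffBox] at key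
    have h1 := ENNReal.toReal_mono ENNReal.one_ne_top key
    rw [ENNReal.toReal_mul, ENNReal.toReal_natCast, ENNReal.toReal_one] at h1
    have hQ : (0 : ℝ) < Nat.card (ResidueField (integers K)) := by
      exact_mod_cast residueCard_pos (K := K)
    rw [measureReal_def]
    have := (le_div_iff₀' hQ).mpr h1
    linarith
  · intro b s hs i
    exact add_mem (t b i).2 (hs.1 i)
  · intro a b s hs s' hs' h
    rw [← ht a, ← ht b, residue_eq_residue]
    have h1 (c : Fin (m + 1) → integers F) :
        ((∑ i, algebraMap (integers F) (integers K) (c i) * x ^ (i : ℕ) : integers K) : K) =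
          ∑ i, (c i : F) • (x : K) ^ (i : ℕ) := by
      rw [AddSubmonoidClass.coe_finsetSum]
      refine Finset.sum_congr rfl fun i _ => ?_
      rw [Algebra.smul_def]
      rfl
    rw [h1, h1]
    have h2 : ∑ i, (t a i : F) • (x : K) ^ (i : ℕ) - ∑ i, (t b i : F) • (x : K) ^ (i : ℕ) =
        ∑ i, s' i • (x : K) ^ (i : ℕ) - ∑ i, s i • (x : K) ^ (i : ℕ) := by
      simp only [← Finset.sum_sub_distrib, ← sub_smul]
      refine Finset.sum_congr rfl fun i _ => ?_
      have := congrFun h i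
      simp only [Pi.add_apply] at this
      congr 1
      linear_combination this
    rw [h2]
    exact (norm_sub_le_max _ _).trans_lt (max_lt hs'.2 hs.2)

end PolyIntegral

end PadicRoots

namespace PadicRoots

open IsLocalRing Metric
open scoped ENNReal

/-! ### The tail outside 𝒪_K -/

section Tail

variable (p : ℕ) [Fact p.Prime] (F : Type*) [NontriviallyNormedField F] [NormedAlgebra ℚ_[p] F]
  [FiniteDimensional ℚ_[p] F] [IsUltrametricDist F] [ProperSpace F] [CharZero F]
  (K : Type*) [NontriviallyNormedField K] [NormedAlgebra F K] [IsUltrametricDist K]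
  [FiniteDimensional F K] [ProperSpace K] [MeasurableSpace K] [BorelSpace K]

/-- On the shell of norm ‖ϖ‖^(-(k+1)) the integrand is Q^(-2(k+1)) and the measure at most Q^(k+1).
The sum is 1/(Q - 1) ≤ 2/Q, as Q ≥ 2. -/
theorem lintegral_inv_nrm_pow_le :
    ∫⁻ x in (closedBall (0 : K) 1)ᶜ,
      ENNReal.ofReal (nrm p F x ^ (2 * Module.finrank F K))⁻¹ ∂(haar K) ≤
      2 * (Nat.card (ResidueField (integers K)) : ℝ≥0∞)⁻¹ := by
  set Q : ℕ := Nat.card (ResidueField (integers K)) with hQ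
  have hQ2 : 1 < Q := one_lt_residueCard
  obtain ⟨ϖ, hϖ⟩ := exists_isUniformizer (K := K)
  let E : ℕ → Set K := fun k => {x | ‖x‖ = ‖ϖ‖ ^ (-((k : ℤ) + 1))}
  have hE (k : ℕ) : MeasurableSet (E k) :=
    (isClosed_eq continuous_norm continuous_const).measurableSet
  have hcov : (closedBall (0 : K) 1)ᶜ ⊆ ⋃ k, E k := by
    intro x hx
    rw [Set.mem_compl_iff, mem_closedBall_zero_iff, not_le] at hx
    obtain ⟨n, hn⟩ := hϖ.exists_zpow (norm_pos_iff.mp (one_pos.trans hx))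
    have hneg : n < 0 := by
      by_contra! h
      rw [hn] at hx
      exact hx.not_ge (zpow_le_one₀ hϖ.norm_pos hϖ.norm_lt_one.le h)
    obtain ⟨k, hk⟩ := Int.eq_ofNat_of_zero_le (show 0 ≤ -n - 1 by lia)
    refine Set.mem_iUnion.mpr ⟨k, ?_⟩
    change ‖x‖ = _
    rw [hn, ← hk]
    congr 1
    ring
  have hval (k : ℕ) (x : K) (hx : x ∈ E k) :
      ENNReal.ofReal (nrm p F x ^ (2 * Module.finrank F K))⁻¹ = ((Q : ℝ≥0∞)⁻¹ ^ 2) ^ (k + 1) := by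
    have h1 : nrm p F x ^ (2 * Module.finrank F K) = ((Q : ℝ) ^ 2) ^ (k + 1) := by
      have h2 := nrm_uniformizer p (F := F) hϖ
      rw [← hQ] at h2
      have h3 : nrm p F x = (nrm p F ϖ)⁻¹ ^ (k + 1) := by
        change ‖x‖ = _ at hx
        rw [nrm, hx, nrm, zpow_neg, ← inv_zpow, ← inv_pow, ← pow_mul, mul_comm, pow_mul]
        norm_cast
      have h4 : ((nrm p F ϖ)⁻¹ ^ (k + 1)) ^ (2 * Module.finrank F K) =
          (((nrm p F ϖ ^ Module.finrank F K)⁻¹) ^ 2) ^ (k + 1) := by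
        simp only [← inv_pow, ← pow_mul]
        congr 1
        ring
      rw [h3, h4, h2, inv_inv]
    rw [h1, ENNReal.ofReal_inv_of_pos (by positivity), ENNReal.ofReal_pow (by positivity),
      ENNReal.ofReal_pow (by positivity), ENNReal.ofReal_natCast, ENNReal.inv_pow, ENNReal.inv_pow]
  have hQ0 : (Q : ℝ≥0∞) ≠ 0 := by exact_mod_cast (by lia : Q ≠ 0)
  have hQt : (Q : ℝ≥0∞) ≠ ∞ := ENNReal.natCast_ne_top _
  have hterm (k : ℕ) : ∫⁻ x in E k,
      ENNReal.ofReal (nrm p F x ^ (2 * Module.finrank F K))⁻¹ ∂(haar K) ≤ (Q : ℝ≥0∞)⁻¹ ^ (k + 1) := by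
    rw [setLIntegral_congr_fun (hE k) (hval k), setLIntegral_const]
    calc _ ≤ ((Q : ℝ≥0∞)⁻¹ ^ 2) ^ (k + 1) * haar K (closedBall 0 (‖ϖ‖ ^ (-((k : ℤ) + 1)))) := by
          gcongr
          intro x hx
          rw [mem_closedBall_zero_iff]
          exact (show ‖x‖ = _ from hx).le
      _ = _ := by
          rw [haar_closedBall_zpow hϖ, neg_neg, ← hQ]
          have : (Q : ℝ≥0∞) ^ ((k : ℤ) + 1) = (Q : ℝ≥0∞) ^ (k + 1) := by norm_cast
          rw [this, ← mul_pow, sq, mul_assoc, ENNReal.inv_mul_cancel hQ0 hQt, mul_one]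
  calc _ ≤ ∫⁻ x in ⋃ k, E k,
        ENNReal.ofReal (nrm p F x ^ (2 * Module.finrank F K))⁻¹ ∂(haar K) := lintegral_mono_set hcov
    _ ≤ ∑' k, ∫⁻ x in E k,
        ENNReal.ofReal (nrm p F x ^ (2 * Module.finrank F K))⁻¹ ∂(haar K) := lintegral_iUnion_le _ _
    _ ≤ ∑' k : ℕ, (Q : ℝ≥0∞)⁻¹ ^ (k + 1) := ENNReal.tsum_le_tsum hterm
    _ = (1 - (Q : ℝ≥0∞)⁻¹)⁻¹ * (Q : ℝ≥0∞)⁻¹ := by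
        rw [ENNReal.tsum_geometric_add_one, mul_comm]
    _ ≤ _ := by
        gcongr
        rw [ENNReal.inv_le_iff_inv_le]
        refine ENNReal.le_sub_of_add_le_right (by simp [hQ0]) ?_
        rw [← ENNReal.inv_two_add_inv_two]
        gcongr
        exact_mod_cast hQ2

end Tail

/-! ### The density divided by the discriminant: bounds and measurability -/

section Weight

variable (p : ℕ) [Fact p.Prime] (F : Type*) [NontriviallyNormedField F] [NormedAlgebra ℚ_[p] F]
  [IsUltrametricDist F] [ProperSpace F] [MeasurableSpace F] [BorelSpace F]
  {K : Type*} [NormedField K] [NormedAlgebra F K] [IsUltrametricDist K]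

open Classical in
/-- The density on `𝒪_K` divided by the norm of the discriminant, extended by `0` to `K`. -/
noncomputable def weight (n : ℕ) (x : K) : ℝ :=
  if hx : x ∈ integers K then
    if Module.finrank F K ≤ n ∧ Algebra.adjoin F {x} = ⊤ then
      (orderIndex F (⟨x, hx⟩ : integers K) : ℝ)⁻¹ * polyIntegral p F (n - Module.finrank F K) x
    else 0
  else 0

open Classical in
theorem weight_coe (n : ℕ) (x : integers K) : weight p F n (x : K) =
    if Module.finrank F K ≤ n ∧ Algebra.adjoin F {(x : K)} = ⊤ then
      (orderIndex F x : ℝ)⁻¹ * polyIntegral p F (n - Module.finrank F K) (x : K)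
    else 0 := by
  rw [weight, dif_pos x.2]

theorem weight_nonneg (n : ℕ) (x : K) : 0 ≤ weight p F n x := by
  unfold weight
  split_ifs
  · exact mul_nonneg (by positivity) (polyIntegral_nonneg p F _ _)
  all_goals exact le_rfl

theorem weight_le_inv_orderIndex (n : ℕ) (x : integers K) :
    weight p F n (x : K) ≤ (orderIndex F x : ℝ)⁻¹ := by
  classical
  rw [weight_coe]
  split_ifs
  · exact mul_le_of_le_one_right (by positivity) (polyIntegral_le_one p F _ (norm_coe_le_one x))
  · positivity

theorem weight_le_polyIntegral (n : ℕ) (x : integers K) :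
    weight p F n (x : K) ≤ polyIntegral p F (n - Module.finrank F K) (x : K) := by
  classical
  rw [weight_coe]
  split_ifs
  -- An infinite index is recorded as 0, whose inverse is 0, so the bound by 1 still holds.
  · exact mul_le_of_le_one_left (polyIntegral_nonneg p F _ _) (Nat.cast_inv_le_one _)
  · exact polyIntegral_nonneg p F _ _

theorem weight_le_one (n : ℕ) (x : K) : weight p F n x ≤ 1 := by
  by_cases hx : x ∈ integers K
  · exact (weight_le_polyIntegral p F n ⟨x, hx⟩).trans
      (polyIntegral_le_one p F _ (mem_integers.mp hx))
  · rw [weight, dif_neg hx]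
    exact zero_le_one

variable [FiniteDimensional F K]

theorem densityInt_eq (n : ℕ) (x : integers K) :
    densityInt p F n x = nrmDisc p F K * weight p F n (x : K) := by
  rw [weight_coe, densityInt]
  split_ifs
  · rw [div_eq_mul_inv, mul_assoc]
  · rw [mul_zero]

theorem density_of_mem (n : ℕ) {x : K} (hx : x ∈ integers K) :
    density p F n x = nrmDisc p F K * weight p F n x := by
  rw [density, dif_pos hx, densityInt_eq]

theorem density_of_notMem (n : ℕ) {x : K} (hx : x ∉ integers K) :
    density p F n x = nrmDisc p F K *
      ((nrm p F x ^ (2 * Module.finrank F K))⁻¹ * weight p F n x⁻¹) := by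
  rw [density, dif_neg hx, densityInt_eq]
  ring

/-- The generators in 𝒪_K form an open set on which the weight is locally a constant times a
continuous function; elsewhere it vanishes. -/
theorem measurable_weight [CharZero F] [MeasurableSpace K] [BorelSpace K] (n : ℕ) :
    Measurable (weight p F n : K → ℝ) := by
  classical
  have := properSpace_ext F K
  let S : Set K := {x | x ∈ integers K ∧ Algebra.adjoin F {x} = ⊤}
  have hnear (x₀ : K) (hx₀ : x₀ ∈ S) : ∃ δ > 0, ∀ x ∈ ball x₀ δ, x ∈ S ∧
      weight p F n x = if Module.finrank F K ≤ n then
        (orderIndex F (⟨x₀, hx₀.1⟩ : integers K) : ℝ)⁻¹ *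
          polyIntegral p F (n - Module.finrank F K) x else 0 := by
    obtain ⟨δ, hδ, h⟩ := exists_adjoin_eq_of_near F (x₀ := ⟨x₀, hx₀.1⟩) hx₀.2
    refine ⟨min δ 1, by positivity, fun x hx => ?_⟩
    rw [mem_ball_iff_norm, lt_min_iff] at hx
    have hxi : x ∈ integers K := by
      rw [mem_integers, ← sub_add_cancel x x₀]
      exact (IsUltrametricDist.norm_add_le_max _ _).trans
        (max_le hx.2.le (mem_integers.mp hx₀.1))
    obtain ⟨h1, h2⟩ := h ⟨x, hxi⟩ hx.1
    refine ⟨⟨hxi, h2⟩, ?_⟩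
    have h3 : orderIndex F (⟨x, hxi⟩ : integers K) = orderIndex F (⟨x₀, hx₀.1⟩ : integers K) := by
      rw [orderIndex, orderIndex, h1]
    have h4 : Algebra.adjoin F {x} = ⊤ := h2
    rw [weight, dif_pos hxi, h3]
    simp only [h4, and_true]
  have hopen : IsOpen S := by
    rw [Metric.isOpen_iff]
    intro x₀ hx₀
    obtain ⟨δ, hδ, h⟩ := hnear x₀ hx₀
    exact ⟨δ, hδ, fun x hx => (h x hx).1⟩
  have hcont : ContinuousOn (weight p F n : K → ℝ) S := by
    intro x₀ hx₀
    obtain ⟨δ, hδ, h⟩ := hnear x₀ hx₀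
    refine ContinuousAt.continuousWithinAt (ContinuousAt.congr_of_eventuallyEq ?_
      (Filter.eventually_of_mem (ball_mem_nhds x₀ hδ) fun x hx => (h x hx).2))
    split_ifs
    · exact ((continuous_polyIntegral p F _).const_mul _).continuousAt
    · exact continuousAt_const
  have heq : (weight p F n : K → ℝ) = S.piecewise (weight p F n) fun _ => 0 := by
    funext x
    by_cases hx : x ∈ S
    · rw [Set.piecewise_eq_of_mem _ _ _ hx]
    · rw [Set.piecewise_eq_of_notMem _ _ _ hx, weight]
      split_ifs with h1 h2
      · exact absurd ⟨h1, h2.2⟩ hx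
      all_goals rfl
  rw [heq]
  exact hcont.measurable_piecewise continuousOn_const hopen.measurableSet

end Weight

end PadicRoots

namespace PadicRoots

open IsLocalRing Metric
open scoped ENNReal

/-! ### Decomposition of 𝒪_K into residue classes -/

section ResidueClass

variable {K : Type*} [NontriviallyNormedField K] [IsUltrametricDist K]

/-- A representative in `𝒪_K` of a residue class. -/
noncomputable def lift (a : ResidueField (integers K)) : integers K :=
  (residue_surjective a).choose

theorem residue_lift (a : ResidueField (integers K)) : residue (integers K) (lift a) = a :=
  (residue_surjective a).choose_spec

theorem exists_residue_eq_of_mem_ball {a : ResidueField (integers K)} {x : K}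
    (hx : x ∈ ball (lift a : K) 1) : ∃ y : integers K, (y : K) = x ∧ residue (integers K) y = a := by
  rw [mem_ball_iff_norm] at hx
  have hx' : x ∈ integers K := by
    rw [mem_integers, ← sub_add_cancel x (lift a : K)]
    exact (IsUltrametricDist.norm_add_le_max _ _).trans (max_le hx.le (norm_coe_le_one _))
  refine ⟨⟨x, hx'⟩, rfl, ?_⟩
  conv_rhs => rw [← residue_lift a]
  exact residue_eq_residue.mpr hx

theorem iUnion_ball_lift : ⋃ a : ResidueField (integers K), ball (lift a : K) 1 =
    (integers K : Set K) := by
  ext x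
  rw [Set.mem_iUnion]
  constructor
  · rintro ⟨a, ha⟩
    obtain ⟨y, rfl, -⟩ := exists_residue_eq_of_mem_ball ha
    exact y.2
  · intro hx
    refine ⟨residue _ ⟨x, hx⟩, ?_⟩
    rw [mem_ball_iff_norm]
    exact residue_eq_residue.mp (residue_lift (residue _ ⟨x, hx⟩)).symm

theorem pairwise_disjoint_ball_lift :
    Pairwise (Function.onFun Disjoint fun a : ResidueField (integers K) => ball (lift a : K) 1) := by
  intro a b hab
  rw [Function.onFun, Set.disjoint_left]
  intro x ha hb
  obtain ⟨y, hy, rfl⟩ := exists_residue_eq_of_mem_ball ha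
  obtain ⟨z, hz, rfl⟩ := exists_residue_eq_of_mem_ball hb
  exact hab (by rw [Subtype.ext (hy.trans hz.symm)])

theorem integers_eq_closedBall : (integers K : Set K) = closedBall 0 1 := by
  ext x
  rw [mem_closedBall_zero_iff]
  exact mem_integers

variable [MeasurableSpace K] [BorelSpace K]

theorem measurableSet_integers : MeasurableSet (integers K : Set K) := by
  rw [integers_eq_closedBall]
  exact isClosed_closedBall.measurableSet

variable [ProperSpace K]

theorem haar_real_ball (x : K) :
    (haar K).real (ball x 1) = 1 / (Nat.card (ResidueField (integers K)) : ℝ) := by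
  rw [measureReal_def, Measure.addHaar_ball_center, haar_ball_one]
  simp

theorem haar_real_closedBall_sq {ϖ : K} (hϖ : IsUniformizer ϖ) (x : K) :
    (haar K).real (closedBall x (‖ϖ‖ ^ 2)) =
      1 / (Nat.card (ResidueField (integers K)) : ℝ) ^ 2 := by
  have h := haar_closedBall_zpow hϖ 2
  rw [measureReal_def, Measure.addHaar_closedBall_center]
  have h2 : ‖ϖ‖ ^ (2 : ℤ) = ‖ϖ‖ ^ 2 := by norm_cast
  rw [← h2, h, ENNReal.zpow_neg]
  simp [zpow_ofNat]

end ResidueClass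

section TailWeight

variable (p : ℕ) [Fact p.Prime] (F : Type*) [NontriviallyNormedField F] [NormedAlgebra ℚ_[p] F]
  [IsUltrametricDist F] [ProperSpace F] [MeasurableSpace F] [BorelSpace F]
  (K : Type*) [NontriviallyNormedField K] [NormedAlgebra F K] [IsUltrametricDist K]

/-- The part of the density outside `𝒪_K`, divided by the norm of the discriminant. -/
noncomputable def tailWeight (n : ℕ) (x : K) : ℝ :=
  (nrm p F x ^ (2 * Module.finrank F K))⁻¹ * weight p F n x⁻¹

theorem tailWeight_nonneg (n : ℕ) (x : K) : 0 ≤ tailWeight p F K n x :=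
  mul_nonneg (inv_nonneg.mpr (pow_nonneg (nrm_nonneg p F x) _)) (weight_nonneg p F n _)

variable [CharZero F] [FiniteDimensional F K] [MeasurableSpace K] [BorelSpace K]

theorem measurable_tailWeight (n : ℕ) : Measurable (tailWeight p F K n) :=
  (((continuous_nrm p F K).measurable.pow_const _).inv).mul
    ((measurable_weight p F n).comp measurable_inv)

theorem two_mul_inv_residueCard_ne_top (K : Type*) [NormedField K] [IsUltrametricDist K]
    [ProperSpace K] :
    2 * (Nat.card (ResidueField (integers K)) : ℝ≥0∞)⁻¹ ≠ ∞ := by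
  refine ENNReal.mul_ne_top (by simp) (ENNReal.inv_ne_top.mpr ?_)
  exact_mod_cast (residueCard_pos (K := K)).ne'

end TailWeight

/-! ### Integration class by class and the final estimates -/

section Main

variable (p : ℕ) [Fact p.Prime] (F : Type*) [NontriviallyNormedField F] [NormedAlgebra ℚ_[p] F]
  [IsUltrametricDist F] [ProperSpace F] [CharZero F]
  [MeasurableSpace F] [BorelSpace F]
  (K : Type*) [NontriviallyNormedField K] [NormedAlgebra F K] [IsUltrametricDist K]
  [FiniteDimensional F K] [ProperSpace K] [MeasurableSpace K] [BorelSpace K]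

theorem integrableOn_weight (n : ℕ) {s : Set K} (hs : s ⊆ closedBall 0 1) :
    IntegrableOn (weight p F n : K → ℝ) s (haar K) := by
  refine IntegrableOn.mono_set ?_ hs
  refine Measure.integrableOn_of_bounded (M := 1) ?_ (measurable_weight p F n).aestronglyMeasurable
    (Filter.Eventually.of_forall fun x => ?_)
  · rw [haar_closedBall_one]
    exact ENNReal.one_ne_top
  · rw [Real.norm_of_nonneg (weight_nonneg p F n x)]
    exact weight_le_one p F n x

/-- The weight is at most the inverse index, hence at most q^d / Q for a class of degree d, and the
class has measure 1/Q. An infinite index gives weight 0. -/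
theorem integral_weight_nongenerator_le (n : ℕ) (a : ResidueField (integers K)) :
    ∫ x in ball (lift a : K) 1, weight p F n x ∂(haar K) ≤
      (residueCard F : ℝ) ^ (minpoly (ResidueField (integers F)) a).natDegree /
        (Nat.card (ResidueField (integers K)) : ℝ) ^ 2 := by
  set Q : ℕ := Nat.card (ResidueField (integers K)) with hQ
  have hQf : (Q : ℝ) = (residueCard F : ℝ) ^ residueDegree F K := by
    rw [hQ, residueCard_ext F K]
    push_cast
    rfl
  have hQ0 : (0 : ℝ) < Q := by exact_mod_cast residueCard_pos (K := K)
  have hsub : ball (lift a : K) 1 ⊆ closedBall 0 1 := by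
    rw [← integers_eq_closedBall, ← iUnion_ball_lift]
    exact Set.subset_iUnion (fun a : ResidueField (integers K) => ball (lift a : K) 1) a
  have hfin : haar K (ball (lift a : K) 1) ≠ ∞ := measure_ball_lt_top.ne
  calc _ ≤ ∫ x in ball (lift a : K) 1, (residueCard F : ℝ) ^
        (minpoly (ResidueField (integers F)) a).natDegree / (Q : ℝ) ∂(haar K) := by
        refine setIntegral_mono_on (integrableOn_weight p F K n hsub) (integrableOn_const hfin)
          isOpen_ball.measurableSet fun x hx => ?_
        obtain ⟨y, rfl, rfl⟩ := exists_residue_eq_of_mem_ball hx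
        refine (weight_le_inv_orderIndex p F n y).trans ?_
        rcases orderIndex_lower_bound F y with h | h
        · rw [h, Nat.cast_zero, inv_zero]
          positivity
        · have hN : (0 : ℝ) < orderIndex F y := by
            have : 0 < residueCard F ^ residueDegree F K := pow_pos (residueCard_pos (K := F)) _
            exact_mod_cast Nat.pos_of_ne_zero fun h0 => by rw [h0] at h; lia
          rw [inv_eq_one_div, div_le_div_iff₀ hN hQ0, one_mul, hQf, mul_comm]
          exact_mod_cast h
    _ = _ := by
        rw [setIntegral_const, haar_real_ball, smul_eq_mul, ← hQ]
        field_simp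

theorem integral_weight_generator_le (n : ℕ) (a : ResidueField (integers K)) {T : ℝ}
    (hT : ∀ x : integers K, residue (integers K) x = a →
      polyIntegral p F (n - Module.finrank F K) (x : K) ≤ T) :
    ∫ x in ball (lift a : K) 1, weight p F n x ∂(haar K) ≤
      T / (Nat.card (ResidueField (integers K)) : ℝ) := by
  have hsub : ball (lift a : K) 1 ⊆ closedBall 0 1 := by
    rw [← integers_eq_closedBall, ← iUnion_ball_lift]
    exact Set.subset_iUnion (fun a : ResidueField (integers K) => ball (lift a : K) 1) a
  calc _ ≤ ∫ x in ball (lift a : K) 1, T ∂(haar K) := by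
        refine setIntegral_mono_on (integrableOn_weight p F K n hsub)
          (integrableOn_const measure_ball_lt_top.ne) isOpen_ball.measurableSet fun x hx => ?_
        obtain ⟨y, rfl, hy⟩ := exists_residue_eq_of_mem_ball hx
        exact (weight_le_polyIntegral p F n y).trans (hT y hy)
    _ = _ := by
        rw [setIntegral_const, haar_real_ball, smul_eq_mul]
        ring

/-- Discard the exceptional ball of measure 1/Q²; on the rest the index is 1 and the weight is the
polynomial integral. -/
theorem le_integral_weight_generator {n : ℕ} (hn : Module.finrank F K ≤ n)
    {a : ResidueField (integers K)}
    (ha : (minpoly (ResidueField (integers F)) a).natDegree = residueDegree F K) {L : ℝ}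
    (hL0 : 0 ≤ L) (hL : ∀ x : integers K, residue (integers K) x = a →
      L ≤ polyIntegral p F (n - Module.finrank F K) (x : K)) :
    L * (1 / (Nat.card (ResidueField (integers K)) : ℝ) -
        1 / (Nat.card (ResidueField (integers K)) : ℝ) ^ 2) ≤
      ∫ x in ball (lift a : K) 1, weight p F n x ∂(haar K) := by
  classical
  have hsub : ball (lift a : K) 1 ⊆ closedBall 0 1 := by
    rw [← integers_eq_closedBall, ← iUnion_ball_lift]
    exact Set.subset_iUnion (fun a : ResidueField (integers K) => ball (lift a : K) 1) a
  obtain ⟨ϖ, hϖ⟩ := exists_isUniformizer (K := K)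
  obtain ⟨x₀, hx₀⟩ := exists_forall_adjoin_eq_top F hϖ ha
  set B := ball (lift a : K) 1
  set D := closedBall x₀ (‖ϖ‖ ^ 2)
  have hfin : haar K (B \ D) ≠ ∞ :=
    ((measure_mono Set.sdiff_subset).trans_lt measure_ball_lt_top).ne
  have hmeas : MeasurableSet (B \ D) :=
    isOpen_ball.measurableSet.diff isClosed_closedBall.measurableSet
  calc L * (1 / (Nat.card (ResidueField (integers K)) : ℝ) -
        1 / (Nat.card (ResidueField (integers K)) : ℝ) ^ 2)
      ≤ L * (haar K).real (B \ D) := by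
        gcongr
        rw [← haar_real_ball (lift a : K), ← haar_real_closedBall_sq hϖ x₀]
        exact le_measureReal_sdiff (measure_closedBall_lt_top.ne)
    _ = ∫ x in B \ D, L ∂(haar K) := by
        rw [setIntegral_const, smul_eq_mul, mul_comm]
    _ ≤ ∫ x in B \ D, weight p F n x ∂(haar K) := by
        refine setIntegral_mono_on (integrableOn_const hfin)
          (integrableOn_weight p F K n (Set.sdiff_subset.trans hsub)) hmeas fun x hx => ?_
        obtain ⟨y, rfl, hy⟩ := exists_residue_eq_of_mem_ball hx.1
        have htop := hx₀ y hy (by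
          have := hx.2
          rwa [mem_closedBall_iff_norm, not_le] at this)
        rw [weight_coe, if_pos ⟨hn, adjoin_eq_top_of_integers F htop⟩, orderIndex_eq_one F htop,
          Nat.cast_one, inv_one, one_mul]
        exact hL y hy
    _ ≤ _ := setIntegral_mono_set (integrableOn_weight p F K n hsub)
        (Filter.Eventually.of_forall fun x => weight_nonneg p F n x)
        Set.sdiff_subset.eventuallyLE

theorem integral_weight_bounds {n : ℕ} (hn : Module.finrank F K ≤ n) {L T : ℝ} (hL0 : 0 ≤ L)
    (hLT : ∀ x : integers K, (minpoly (ResidueField (integers F)) (residue (integers K) x)).natDegree =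
      residueDegree F K → L ≤ polyIntegral p F (n - Module.finrank F K) (x : K) ∧
        polyIntegral p F (n - Module.finrank F K) (x : K) ≤ T) :
    mobiusSum (residueCard F) (residueDegree F K) * L *
        (1 - 1 / (Nat.card (ResidueField (integers K)) : ℝ)) ≤
      ∫ x in (integers K : Set K), weight p F n x ∂(haar K) ∧
    ∫ x in (integers K : Set K), weight p F n x ∂(haar K) ≤
      mobiusSum (residueCard F) (residueDegree F K) * T +
        2 / (Nat.card (ResidueField (integers K)) : ℝ) := by
  classical
  have := finite_residueField (K := F)
  have := finite_residueField (K := K)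
  have := Fintype.ofFinite (ResidueField (integers K))
  set Q : ℕ := Nat.card (ResidueField (integers K)) with hQ
  have hQf : (Q : ℝ) = (residueCard F : ℝ) ^ residueDegree F K := by
    rw [hQ, residueCard_ext F K]
    push_cast
    rfl
  have hQ0 : (0 : ℝ) < Q := by exact_mod_cast residueCard_pos (K := K)
  let P : ResidueField (integers K) → Prop := fun a =>
    (minpoly (ResidueField (integers F)) a).natDegree = residueDegree F K
  let I : ResidueField (integers K) → ℝ := fun a =>
    ∫ x in ball (lift a : K) 1, weight p F n x ∂(haar K)
  have hsplit : ∫ x in (integers K : Set K), weight p F n x ∂(haar K) =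
      ∑ a with P a, I a + ∑ a with ¬ P a, I a := by
    rw [Finset.sum_filter_add_sum_filter_not, ← iUnion_ball_lift,
      integral_iUnion_fintype (fun a => isOpen_ball.measurableSet) pairwise_disjoint_ball_lift]
    intro a
    refine integrableOn_weight p F K n ?_
    rw [← integers_eq_closedBall, ← iUnion_ball_lift]
    exact Set.subset_iUnion (fun a : ResidueField (integers K) => ball (lift a : K) 1) a
  have hcard : ((Finset.univ.filter P).card : ℝ) =
      mobiusSum (residueCard F) (residueDegree F K) * Q := by
    rw [hQf]
    exact card_generators_eq_mobiusSum (ResidueField (integers F)) (ResidueField (integers K))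
  have h1 : ∑ a with P a, I a ≤ mobiusSum (residueCard F) (residueDegree F K) * T := by
    calc _ ≤ ∑ a with P a, T / (Q : ℝ) := by
          refine Finset.sum_le_sum fun a ha => integral_weight_generator_le p F K n a ?_
          rintro x rfl
          exact (hLT x (Finset.mem_filter.mp ha).2).2
      _ = _ := by
          rw [Finset.sum_const, nsmul_eq_mul, hcard]
          field_simp
  have h2 : mobiusSum (residueCard F) (residueDegree F K) * L * (1 - 1 / (Q : ℝ)) ≤
      ∑ a with P a, I a := by
    calc _ = ∑ a with P a, L * (1 / (Q : ℝ) - 1 / (Q : ℝ) ^ 2) := by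
          rw [Finset.sum_const, nsmul_eq_mul, hcard]
          field_simp
      _ ≤ _ := by
          refine Finset.sum_le_sum fun a ha => ?_
          refine le_integral_weight_generator p F K hn (Finset.mem_filter.mp ha).2 hL0 ?_
          rintro x rfl
          exact (hLT x (Finset.mem_filter.mp ha).2).1
  have h3 : 0 ≤ ∑ a with ¬ P a, I a :=
    Finset.sum_nonneg fun a _ => integral_nonneg fun x => weight_nonneg p F n x
  have h4 : ∑ a with ¬ P a, I a ≤ 2 / (Q : ℝ) := by
    have hsum := sum_pow_natDegree_minpoly_le (ResidueField (integers F)) (ResidueField (integers K))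
    have hsum' : ∑ a with ¬ P a,
        (residueCard F : ℝ) ^ (minpoly (ResidueField (integers F)) a).natDegree ≤ 2 * Q := by
      rw [hQf]
      exact_mod_cast hsum
    calc _ ≤ ∑ a with ¬ P a, (residueCard F : ℝ) ^
          (minpoly (ResidueField (integers F)) a).natDegree / (Q : ℝ) ^ 2 :=
          Finset.sum_le_sum fun a _ => integral_weight_nongenerator_le p F K n a
      _ = (∑ a with ¬ P a, (residueCard F : ℝ) ^
          (minpoly (ResidueField (integers F)) a).natDegree) / (Q : ℝ) ^ 2 :=
          (Finset.sum_div _ _ _).symm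
      _ ≤ 2 * Q / (Q : ℝ) ^ 2 := by gcongr
      _ = _ := by field_simp
  rw [hsplit]
  constructor <;> linarith

theorem integrableOn_density_integers (n : ℕ) :
    IntegrableOn (density p F n : K → ℝ) (integers K : Set K) (haar K) := by
  have h := (integrableOn_weight p F K n (s := (integers K : Set K))
    integers_eq_closedBall.le).const_mul (nrmDisc p F K)
  exact IntegrableOn.congr_fun h (fun x hx => (density_of_mem p F n hx).symm) measurableSet_integers

variable [FiniteDimensional ℚ_[p] F]

theorem lintegral_tailWeight_le (n : ℕ) :
    ∫⁻ x in (integers K : Set K)ᶜ, ENNReal.ofReal (tailWeight p F K n x) ∂(haar K) ≤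
      2 * (Nat.card (ResidueField (integers K)) : ℝ≥0∞)⁻¹ := by
  rw [integers_eq_closedBall]
  refine le_trans (lintegral_mono fun x => ENNReal.ofReal_le_ofReal ?_)
    (lintegral_inv_nrm_pow_le p F K)
  exact mul_le_of_le_one_right (inv_nonneg.mpr (pow_nonneg (nrm_nonneg p F x) _))
    (weight_le_one p F n _)

theorem integrableOn_tailWeight (n : ℕ) :
    IntegrableOn (tailWeight p F K n) (integers K : Set K)ᶜ (haar K) := by
  refine ⟨(measurable_tailWeight p F K n).aestronglyMeasurable, ?_⟩
  rw [hasFiniteIntegral_iff_ofReal (Filter.Eventually.of_forall (tailWeight_nonneg p F K n))]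
  exact (lintegral_tailWeight_le p F K n).trans_lt (two_mul_inv_residueCard_ne_top K).lt_top

theorem integral_tailWeight_le (n : ℕ) :
    ∫ x in (integers K : Set K)ᶜ, tailWeight p F K n x ∂(haar K) ≤
      2 / (Nat.card (ResidueField (integers K)) : ℝ) := by
  rw [integral_eq_lintegral_of_nonneg_ae (Filter.Eventually.of_forall (tailWeight_nonneg p F K n))
    (measurable_tailWeight p F K n).aestronglyMeasurable]
  refine (ENNReal.toReal_mono (two_mul_inv_residueCard_ne_top K)
    (lintegral_tailWeight_le p F K n)).trans_eq ?_
  simp [div_eq_mul_inv]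

theorem integrable_density (n : ℕ) : Integrable (density p F n : K → ℝ) (haar K) := by
  rw [← integrableOn_univ, ← Set.union_compl_self (integers K : Set K)]
  refine (integrableOn_density_integers p F K n).union ?_
  exact IntegrableOn.congr_fun ((integrableOn_tailWeight p F K n).const_mul (nrmDisc p F K))
    (fun x hx => (density_of_notMem p F n hx).symm) measurableSet_integers.compl

theorem rho_div_nrmDisc (n : ℕ) : rho p F K n / nrmDisc p F K =
    (∫ x in (integers K : Set K), weight p F n x ∂(haar K)) +
      ∫ x in (integers K : Set K)ᶜ, tailWeight p F K n x ∂(haar K) := by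
  rw [rho, ← integral_add_compl measurableSet_integers (integrable_density p F K n),
    setIntegral_congr_fun measurableSet_integers fun x hx => density_of_mem p F n hx,
    setIntegral_congr_fun measurableSet_integers.compl fun x hx => density_of_notMem p F n hx,
    integral_const_mul, integral_const_mul, ← mul_add,
    mul_div_cancel_left₀ _ (nrmDisc_pos F K p).ne']
  rfl

/-- With ε = 1/Q, the upper error is ε from the polynomial integral, 2ε from nongenerating classes
and 2ε from the tail. The lower error is at most 2ε: the polynomial integral and the exceptional
balls. -/
theorem abs_rho_div_nrmDisc_sub_le {n : ℕ} (hn : Module.finrank F K ≤ n) {T : ℝ} (hT0 : 0 ≤ T)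
    (hT1 : T ≤ 1)
    (hT : ∀ x : integers K,
      (minpoly (ResidueField (integers F)) (residue (integers K) x)).natDegree = residueDegree F K →
      |polyIntegral p F (n - Module.finrank F K) (x : K) - T| ≤
        1 / (Nat.card (ResidueField (integers K)) : ℝ)) :
    |rho p F K n / nrmDisc p F K - T * mobiusSum (residueCard F) (residueDegree F K)| ≤
      5 * (1 / (residueCard F : ℝ) ^ residueDegree F K) := by
  have := finite_residueField (K := F)
  have := finite_residueField (K := K)
  have := Fintype.ofFinite (ResidueField (integers K))
  have hQf : (residueCard F : ℝ) ^ residueDegree F K = Nat.card (ResidueField (integers K)) := by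
    rw [residueCard_ext F K]
    push_cast
    rfl
  have hQ1 : (1 : ℝ) ≤ Nat.card (ResidueField (integers K)) := by
    exact_mod_cast residueCard_pos (K := K)
  obtain ⟨hM0, hM1⟩ : 0 ≤ mobiusSum (residueCard F) (residueDegree F K) ∧
      mobiusSum (residueCard F) (residueDegree F K) ≤ 1 :=
    mobiusSum_nonneg_and_le_one (ResidueField (integers F)) (ResidueField (integers K))
  obtain ⟨h1, h2⟩ := integral_weight_bounds p F K hn
    -- Truncation at 0 because the class-by-class lower bound needs L ≥ 0.
    (L := max (T - 1 / (Nat.card (ResidueField (integers K)) : ℝ)) 0)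
    (T := T + 1 / (Nat.card (ResidueField (integers K)) : ℝ)) (le_max_right _ _)
    (fun x hx => by
      have := abs_le.mp (hT x hx)
      exact ⟨max_le (by linarith) (polyIntegral_nonneg p F _ _), by linarith⟩)
  have h3 := integral_tailWeight_le p F K n
  have h4 : 0 ≤ ∫ x in (integers K : Set K)ᶜ, tailWeight p F K n x ∂(haar K) :=
    integral_nonneg fun x => tailWeight_nonneg p F K n x
  rw [rho_div_nrmDisc, hQf]
  set M := mobiusSum (residueCard F) (residueDegree F K)
  set ε : ℝ := 1 / (Nat.card (ResidueField (integers K)) : ℝ) with hε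
  have hε0 : 0 ≤ ε := by positivity
  have hε1 : ε ≤ 1 := by
    rw [hε, div_le_one (by linarith)]
    exact hQ1
  have h2ε : 2 / (Nat.card (ResidueField (integers K)) : ℝ) = 2 * ε := by rw [hε]; ring
  rw [h2ε] at h2 h3
  have h5 : M * (T - ε) * (1 - ε) ≤ M * max (T - ε) 0 * (1 - ε) := by
    have : 0 ≤ 1 - ε := by linarith
    gcongr
    exact le_max_left _ _
  have h6 : M * T - 2 * ε ≤ M * (T - ε) * (1 - ε) := by
    have hMT : M * T ≤ 1 := mul_le_one₀ hM1 hT0 hT1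
    nlinarith [mul_nonneg hM0 (mul_nonneg hε0 hε0), mul_nonneg hε0 (sub_nonneg.mpr hMT),
      mul_nonneg hε0 (sub_nonneg.mpr hM1)]
  have h7 : M * ε ≤ ε := mul_le_of_le_one_left hε0 hM1
  rw [abs_le]
  constructor <;> nlinarith

theorem rho_finrank_estimate :
    |rho p F K (Module.finrank F K) / nrmDisc p F K -
      (1 - 1 / (residueCard F : ℝ)) * mobiusSum (residueCard F) (residueDegree F K)| ≤
      5 * (1 / (residueCard F : ℝ) ^ residueDegree F K) := by
  have hq1 : (1 : ℝ) ≤ residueCard F := by exact_mod_cast residueCard_pos (K := F)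
  have hq : 1 / (residueCard F : ℝ) ≤ 1 := by
    rw [div_le_one (by linarith)]
    exact hq1
  have hq0 : 0 ≤ 1 / (residueCard F : ℝ) := by positivity
  refine abs_rho_div_nrmDisc_sub_le p F K le_rfl (by linarith) (by linarith) fun x _ => ?_
  rw [Nat.sub_self]
  obtain ⟨h1, h2⟩ := polyIntegral_zero_bounds p F (norm_coe_le_one x)
  have h3 : 1 / (residueCard F : ℝ) ^ Module.finrank F K ≤
      1 / (Nat.card (ResidueField (integers K)) : ℝ) := by
    rw [residueCard_ext F K, Nat.cast_pow]
    gcongr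
    · exact residueDegree_le F K
  rw [abs_le]
  constructor
  · have : 0 ≤ 1 / (Nat.card (ResidueField (integers K)) : ℝ) := by positivity
    linarith
  · linarith

theorem rho_estimate {n : ℕ} (hn : 2 * Module.finrank F K - 1 ≤ n) :
    |rho p F K n / nrmDisc p F K - mobiusSum (residueCard F) (residueDegree F K)| ≤
      5 * (1 / (residueCard F : ℝ) ^ residueDegree F K) := by
  have hr : 0 < Module.finrank F K := Module.finrank_pos
  have hf := residueDegree_le F K
  have h := abs_rho_div_nrmDisc_sub_le p F K (n := n) (by lia) zero_le_one le_rfl fun x hx => ?_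
  · rwa [one_mul] at h
  -- The threshold 2r - 1 enters here: n - r + 1 ≥ r ≥ f coefficients.
  · have h1 := one_sub_le_polyIntegral p F (m := n - Module.finrank F K) (by lia) hx
    have h2 := polyIntegral_le_one p F (n - Module.finrank F K) (norm_coe_le_one x)
    have h3 : 0 ≤ 1 / (Nat.card (ResidueField (integers K)) : ℝ) := by positivity
    rw [abs_le]
    constructor <;> linarith

end Main

end PadicRoots

theorem theoremD :
    ∃ C : ℝ, ∀ (p : ℕ) [Fact p.Prime]
      (F : Type*) [NontriviallyNormedField F] [NormedAlgebra ℚ_[p] F] [FiniteDimensional ℚ_[p] F]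
      [MeasurableSpace F] [BorelSpace F]
      (K : Type*) [NormedField K] [NormedAlgebra F K] [FiniteDimensional F K]
      [MeasurableSpace K] [BorelSpace K],
      haveI := PadicRoots.isUltrametricDist_base p F
      haveI := PadicRoots.properSpace_base p F
      haveI := PadicRoots.isUltrametricDist_ext F K
      haveI := PadicRoots.properSpace_ext F K
      let q : ℕ := PadicRoots.residueCard F
      let r : ℕ := Module.finrank F K
      let f : ℕ := PadicRoots.residueDegree F K
      (Integrable (PadicRoots.density p F (K := K) r) (PadicRoots.haar K) ∧
        |PadicRoots.rho p F K r / PadicRoots.nrmDisc p F K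
            - (1 - 1 / (q : ℝ)) * PadicRoots.mobiusSum q f| ≤ C * (1 / (q : ℝ) ^ f)) ∧
      ∀ n : ℕ, 2 * r - 1 ≤ n →
        Integrable (PadicRoots.density p F (K := K) n) (PadicRoots.haar K) ∧
        |PadicRoots.rho p F K n / PadicRoots.nrmDisc p F K
            - PadicRoots.mobiusSum q f| ≤ C * (1 / (q : ℝ) ^ f) := by
  refine ⟨5, ?_⟩
  intro p _ F _ _ _ _ _ K hK _ _ _ _
  have := PadicRoots.isUltrametricDist_base p F
  have := PadicRoots.properSpace_base p F
  have := PadicRoots.isUltrametricDist_ext F K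
  have := PadicRoots.properSpace_ext F K
  have := PadicRoots.charZero_base p F
  -- Nontriviality of the norm is inherited from F; the underlying normed field structure is
  -- unchanged.
  let _ : NontriviallyNormedField K :=
    { hK with
      non_trivial := by
        obtain ⟨x, hx⟩ := NormedField.exists_one_lt_norm F
        exact ⟨algebraMap F K x, by rwa [norm_algebraMap']⟩ }
  exact ⟨⟨PadicRoots.integrable_density p F K _, PadicRoots.rho_finrank_estimate p F K⟩,
    fun n hn => ⟨PadicRoots.integrable_density p F K n, PadicRoots.rho_estimate p F K hn⟩⟩
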